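/- All topological spaces are compactly generated (their topology is the final one for continuous maps from compact Hausdorff spaces; no separation axiom is assumed), products, fibre products, subspaces and mapping spaces are formed in the category $\mathsf{Top}$ of such spaces, and $\mathsf{Top}$ carries the Grothendieck topology of open coverings. A stack means a stack in groupoids over $\mathsf{Top}$. A morphism $X\to\mathfrak X$ from a space to a stack is representable if for every space $T$ and every morphism $T\to\mathfrak X$ the fibre product $X\times_{\mathfrak X}T$ is (equivalent to) a space; it is an epimorphism if every morphism $T\to\mathfrak X$ from a space lifts to $X$, up to a 2-isomorphism, on an open neighbourhood of each point of $T$. A stack $\mathfrak X$ is pretopological if it admits a representable epimorphism from a space. A groupoid presentation of $\mathfrak X$ consists of a topological groupoid $\mathbb X=[X_1\rightrightarrows X_0]$ (source and target are only required to be continuous), an epimorphism $\pi\colon X_0\to\mathfrak X$ and a 2-isomorphism $\varphi\colon \pi\circ s\Rightarrow\pi\circ t$ that identifies $X_1$ with $X_0\times_{\mathfrak X}X_0$, compatibly with composition. For a space $A$, the mapping stack $\mathbf{Hom}(A,\mathfrak X)$ is given by $T\mapsto \mathrm{Hom}(T\times A,\mathfrak X)=\mathfrak X(T\times A)$. **Proposition.**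 Let $\mathfrak X$ be a pretopological stack and let $A$ be a compact Hausdorff space. Then: 1. $\mathbf{Hom}(A,\mathfrak X)$ is a pretopological stack. 2. The diagonal of $\mathbf{Hom}(A,\mathfrak X)$ is representable: for every space $T$ and every two morphisms $y,z\colon T\to\mathbf{Hom}(A,\mathfrak X)$, the sheaf over $T$ of 2-isomorphisms from $y$ to $z$ is a space. 3. $\mathfrak X$ has a groupoid presentation, and for every groupoid presentation $(\mathbb X,\pi,\varphi)$ of $\mathfrak X$ the following holds. For a finite open cover $\alpha$ of $A$ (a finite set of open subsets with union $A$), let $U_\alpha$ be the disjoint union of the members of $\alpha$, let $\mathbb A_\alpha=[U_\alpha\times_AU_\alpha\rightrightarrows U_\alpha]$, and let $R_\alpha$ be the space of continuous groupoid morphisms $\mathbb A_\alpha\to\mathbb X$, topologized as a subspace of $\mathrm{Map}(U_\alpha\times_AU_\alpha,X_1)\times\mathrm{Map}(U_\alpha,X_0)$, with the compact-open topology on the mapping spaces. Then there is a representable epimorphism $$R:=\coprod_\alpha R_\alpha\longrightarrow\mathbf{Hom}(A,\mathfrak X),$$ where $\alpha$ runs over all finite open covers of $A$, whose restriction to each $R_\alpha$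 corresponds to the morphism $\rho_\alpha\colon R_\alpha\times A\to\mathfrak X$ given by the universal groupoid morphism $R_\alpha\times\mathbb A_\alpha\to\mathbb X$. That is, there is a 2-isomorphism $\theta$ from the restriction of $\rho_\alpha$ to $R_\alpha\times U_\alpha$ to the composite $R_\alpha\times U_\alpha\xrightarrow{\mathrm{ev}_0}X_0\xrightarrow{\pi}\mathfrak X$ such that on $R_\alpha\times(U_\alpha\times_AU_\alpha)$ the pullback of $\theta$ along the source map, followed by the pullback of $\varphi$ along $\mathrm{ev}_1\colon R_\alpha\times(U_\alpha\times_AU_\alpha)\to X_1$, equals the pullback of $\theta$ along the target map. -/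

import Mathlib

open CategoryTheory Opposite TopologicalSpace

universe u v w

namespace PretopStack

/-! ### Compactly generated spaces -/

/-- The category of compactly generated topological spaces (no separation axiom): the topology is
the final one for the continuous maps from compact Hausdorff spaces. -/
abbrev Spc : Type (u + 1) := CompactlyGenerated.{u, u}

/-- A continuous map, as a morphism of `Spc`. -/
abbrev mkHom {X Y : Spc.{u}} (f : X → Y) (hf : Continuous f) : X ⟶ Y :=
  ConcreteCategory.ofHom (C := Spc.{u}) (⟨f, hf⟩ : C(X, Y))

theorem continuous_hom {X Y : Spc.{u}} (f : X ⟶ Y) : Continuous f :=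
  (ConcreteCategory.hom f : C(X, Y)).continuous

theorem compactlyGenerated_comp (X : Type u) [t : TopologicalSpace X] (K : CompHaus.{u})
    (g : C(K, X)) : @Continuous K X _ (TopologicalSpace.compactlyGenerated.{u} X) g := by
  let tX := TopologicalSpace.compactlyGenerated.{u} X
  let q : (Σ i : (S : CompHaus.{u}) × (@ContinuousMap S X _ t), i.fst) → X := fun p => p.1.2 p.2
  have hq : Continuous q := continuous_coinduced_rng
  exact hq.comp (continuous_sigmaMk (σ := fun i : (S : CompHaus.{u}) × (@ContinuousMap S X _ t) =>
    (i.fst : Type u)) (i := ⟨K, g⟩))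

theorem compactlyGenerated_le (X : Type u) [t : TopologicalSpace X] :
    TopologicalSpace.compactlyGenerated.{u} X ≤ t := by
  rw [← continuous_id_iff_le]
  exact @continuous_from_compactlyGenerated X X t t id (fun S g => g.continuous)

theorem uCompactlyGeneratedSpace_kify (X : Type u) [t : TopologicalSpace X] :
    @UCompactlyGeneratedSpace.{u} X (TopologicalSpace.compactlyGenerated.{u} X) :=
  @uCompactlyGeneratedSpace_of_continuous_maps X (TopologicalSpace.compactlyGenerated.{u} X)
    (fun {Y} tY f h => @continuous_from_compactlyGenerated X Y t tY f (fun S g =>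
      h S (@ContinuousMap.mk S X _ (TopologicalSpace.compactlyGenerated.{u} X) g
        (compactlyGenerated_comp X S g))))

/-- The set `X` with the compactly generated topology attached to the topology of `X`. -/
def kify (X : Type u) [TopologicalSpace X] : Spc.{u} :=
  @CompactlyGenerated.of X (TopologicalSpace.compactlyGenerated.{u} X)
    (uCompactlyGeneratedSpace_kify X)

namespace kify

/-- The identity map `X → kify X`, on points. -/
def mk {X : Type u} [TopologicalSpace X] (x : X) : kify X := x

/-- The identity map `kify X → X`, on points. -/
def val {X : Type u} [TopologicalSpace X] (x : kify X) : X := x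

theorem continuous_val {X : Type u} [t : TopologicalSpace X] :
    Continuous (val : kify X → X) :=
  continuous_id_iff_le.2 (compactlyGenerated_le X)

/-- A continuous map from a compactly generated space to `X` is continuous into `kify X`. -/
theorem continuous_mk_comp {X : Type u} [t : TopologicalSpace X] {T : Spc.{u}} (f : T → X)
    (hf : Continuous f) : Continuous (fun s => (mk (f s) : kify X)) :=
  continuous_from_uCompactlyGeneratedSpace.{u} _ (fun S g =>
    compactlyGenerated_comp X S ⟨f ∘ g, hf.comp g.continuous⟩)

/-- To be continuous on `kify X` is to be continuous along all maps from compact Hausdorff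
spaces to `X`. -/
theorem continuous_of_compHaus {X : Type u} [t : TopologicalSpace X] {Y : Type u}
    [TopologicalSpace Y] (f : kify X → Y)
    (h : ∀ (S : CompHaus.{u}) (g : C(S, X)), Continuous (fun s => f (mk (g s)))) :
    Continuous f :=
  @continuous_from_compactlyGenerated X Y t _ f h

end kify

/-- The product of two compactly generated spaces, in the category of compactly generated
spaces. -/
def prod (X Y : Spc.{u}) : Spc.{u} := kify (X × Y)

namespace prod

/-- The point `(x, y)` of the product. -/
def mk {X Y : Spc.{u}} (x : X) (y : Y) : prod X Y := kify.mk (x, y)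

/-- First projection. -/
def fst (X Y : Spc.{u}) : prod X Y ⟶ X :=
  mkHom (fun p => (kify.val p).1) (continuous_fst.comp kify.continuous_val)

/-- Second projection. -/
def snd (X Y : Spc.{u}) : prod X Y ⟶ Y :=
  mkHom (fun p => (kify.val p).2) (continuous_snd.comp kify.continuous_val)

/-- The map to the product with given components. -/
def lift {T X Y : Spc.{u}} (f : T ⟶ X) (g : T ⟶ Y) : T ⟶ prod X Y :=
  mkHom (fun s => mk (f s) (g s))
    (kify.continuous_mk_comp (X := X × Y) (fun s => (f s, g s))
      ((continuous_hom f).prodMk (continuous_hom g)))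

/-- The product of two maps. -/
def map {X X' Y Y' : Spc.{u}} (f : X ⟶ X') (g : Y ⟶ Y') : prod X Y ⟶ prod X' Y' :=
  lift (fst X Y ≫ f) (snd X Y ≫ g)

end prod

/-- The functor `T ↦ T × A` on compactly generated spaces. -/
def prodRight (A : Spc.{u}) : Spc.{u} ⥤ Spc.{u} where
  obj T := prod T A
  map f := prod.map f (𝟙 A)
  map_id _ := rfl
  map_comp _ _ := rfl

/-- The fibre product of `f : X ⟶ Z` and `g : Y ⟶ Z` in the category of compactly generated
spaces. -/
def pb {X Y Z : Spc.{u}} (f : X ⟶ Z) (g : Y ⟶ Z) : Spc.{u} :=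
  kify {p : X × Y // f p.1 = g p.2}

namespace pb

variable {X Y Z : Spc.{u}} {f : X ⟶ Z} {g : Y ⟶ Z}

/-- The point `(x, y)` of the fibre product. -/
def mk (x : X) (y : Y) (h : f x = g y) : pb f g := kify.mk ⟨(x, y), h⟩

/-- First projection. -/
def fst (f : X ⟶ Z) (g : Y ⟶ Z) : pb f g ⟶ X :=
  mkHom (fun p => (kify.val p).1.1)
    (continuous_fst.comp (continuous_subtype_val.comp kify.continuous_val))

/-- Second projection. -/
def snd (f : X ⟶ Z) (g : Y ⟶ Z) : pb f g ⟶ Y :=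
  mkHom (fun p => (kify.val p).1.2)
    (continuous_snd.comp (continuous_subtype_val.comp kify.continuous_val))

theorem condition (f : X ⟶ Z) (g : Y ⟶ Z) (p : pb f g) : f (fst f g p) = g (snd f g p) :=
  (kify.val p).2

/-- The map to the fibre product with given components. -/
def lift {T : Spc.{u}} (a : T ⟶ X) (b : T ⟶ Y) (h : ∀ s, f (a s) = g (b s)) : T ⟶ pb f g :=
  mkHom (fun s => mk (a s) (b s) (h s))
    (kify.continuous_mk_comp (X := {p : X × Y // f p.1 = g p.2}) (fun s => ⟨(a s, b s), h s⟩)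
      (((continuous_hom a).prodMk (continuous_hom b)).subtype_mk _))

end pb

theorem locallyCompactSpace_compHaus (S : CompHaus.{u}) : LocallyCompactSpace S :=
  have h : ∀ (K : Type u) [TopologicalSpace K] [CompactSpace K] [T2Space K],
    LocallyCompactSpace K := fun _ _ _ _ => inferInstance
  h S

/-- An open subset of a compactly generated space is compactly generated. -/
theorem uCompactlyGeneratedSpace_opens {X : Type u} [TopologicalSpace X]
    [UCompactlyGeneratedSpace.{u} X] (U : Opens X) : UCompactlyGeneratedSpace.{u} U := by
  refine uCompactlyGeneratedSpace_of_isOpen fun s hs => ?_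
  rw [U.isOpen.isOpenEmbedding_subtypeVal.isOpen_iff_image_isOpen]
  refine UCompactlyGeneratedSpace.isOpen.{u} fun S g => ?_
  rw [isOpen_iff_mem_nhds]
  intro k hk
  obtain ⟨⟨y, hyU⟩, hys, hyk⟩ := hk
  have hkU : g k ∈ U := by simpa [← hyk] using hyU
  have := locallyCompactSpace_compHaus S
  obtain ⟨L, hLk, hLU, hLc⟩ :=
    local_compact_nhds ((U.isOpen.preimage g.continuous).mem_nhds hkU)
  have : CompactSpace L := isCompact_iff_compactSpace.1 hLc
  let gL : C(CompHaus.of L, U) :=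
    ⟨fun l => ⟨g l.1, hLU l.2⟩, (g.continuous.comp continuous_subtype_val).subtype_mk _⟩
  have h1 : IsOpen (gL ⁻¹' s) := hs (CompHaus.of L) gL
  have hkL : k ∈ L := mem_of_mem_nhds hLk
  have h2 : (gL ⁻¹' s : Set L) ∈ nhds (⟨k, hkL⟩ : L) := by
    refine h1.mem_nhds ?_
    change (⟨g k, _⟩ : U) ∈ s
    have hy : (⟨g k, hkU⟩ : U) = ⟨y, hyU⟩ := Subtype.ext hyk.symm
    rw [show (⟨g k, _⟩ : U) = ⟨y, hyU⟩ from hy]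
    exact hys
  have h3 := (mem_nhds_induced Subtype.val _ _).1
    (show (gL ⁻¹' s : Set L) ∈ (nhds (⟨k, hkL⟩ : L)) from h2)
  obtain ⟨V, hV, hVs⟩ := h3
  filter_upwards [hV, hLk] with l hlV hlL
  exact ⟨⟨g l, hLU hlL⟩, hVs (show (⟨l, hlL⟩ : L) ∈ Subtype.val ⁻¹' V from hlV), rfl⟩

instance {X : Type u} [TopologicalSpace X] [UCompactlyGeneratedSpace.{u} X] (U : Opens X) :
    UCompactlyGeneratedSpace.{u} U := uCompactlyGeneratedSpace_opens U

/-! ### The site of topological spaces -/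

/-- The Grothendieck topology of open coverings: a sieve on `X` is covering if every point of `X`
lies in the image of an open embedding that belongs to the sieve. -/
def openCoverTopology : GrothendieckTopology Spc.{u} where
  sieves X := {R | ∀ x : X, ∃ (U : Spc.{u}) (i : U ⟶ X),
    Topology.IsOpenEmbedding i ∧ x ∈ Set.range i ∧ R i}
  top_mem' X x := ⟨X, 𝟙 X, Topology.IsOpenEmbedding.id, ⟨x, rfl⟩, trivial⟩
  pullback_stable' X Y R f hR y := by
    obtain ⟨U, i, hi, ⟨z, hz⟩, hRi⟩ := hR (f y)
    let V : Opens Y := ⟨f ⁻¹' Set.range i, hi.isOpen_range.preimage (continuous_hom f)⟩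
    let j : CompactlyGenerated.of.{u, u} V ⟶ Y :=
      mkHom (fun p => p.1) continuous_subtype_val
    let e := hi.isEmbedding.toHomeomorph
    let k : CompactlyGenerated.of.{u, u} V ⟶ U :=
      mkHom (fun p => e.symm ⟨f p.1, p.2⟩) (e.symm.continuous.comp
        (((continuous_hom f).comp continuous_subtype_val).subtype_mk _))
    refine ⟨_, j, V.isOpen.isOpenEmbedding_subtypeVal, ⟨⟨y, ⟨z, hz⟩⟩, rfl⟩, ?_⟩
    have hk : k ≫ i = j ≫ f := by
      ext p
      exact congrArg Subtype.val (e.apply_symm_apply ⟨f p.1, p.2⟩)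
    change R (j ≫ f)
    rw [← hk]
    exact R.downward_closed hRi k
  transitive' X R hR R' h x := by
    obtain ⟨U, i, hi, ⟨z, rfl⟩, hRi⟩ := hR x
    obtain ⟨V, j, hj, ⟨z', rfl⟩, hR'⟩ := h hRi z
    exact ⟨V, j ≫ i, hi.comp hj, ⟨z', rfl⟩, hR'⟩

/-! ### Stacks, and morphisms from spaces to stacks

A stack over the site of spaces is a pseudofunctor to categories with values in groupoids that
satisfies descent. By the 2-Yoneda lemma, a morphism from a space `T` to a stack `F` is the same
thing as an object of the groupoid `F(T)`, and a 2-isomorphism of such morphisms is an isomorphism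
in `F(T)`; morphisms from spaces to stacks are written in this way throughout. -/

/-- Pseudofunctors on the category of spaces with values in categories. -/
abbrev CatPresheaf := Pseudofunctor (LocallyDiscrete Spc.{u}ᵒᵖ) Cat.{v, w}

/-- The category `F(T)`, that is, the category of morphisms `T ⟶ F`. -/
abbrev fib (F : CatPresheaf.{u, v, w}) (T : Spc.{u}) := F.obj (.mk (op T))

/-- The pullback `f^* x` of `x ∈ F(T)` along `f : S ⟶ T`, that is, the composite `S ⟶ T ⟶ F`. -/
abbrev pull {F : CatPresheaf.{u, v, w}} {S T : Spc.{u}} (f : S ⟶ T) (x : fib F T) : fib F S :=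
  (F.map f.op.toLoc).toFunctor.obj x

/-- Given `φ : a^* x ⟶ b^* y` over `S`, the pullback of `φ` along `h : S' ⟶ S`, viewed as a
morphism `a'^* x ⟶ b'^* y`, where `a' = h ≫ a` and `b' = h ≫ b`. -/
abbrev pullMor {F : CatPresheaf.{u, v, w}} {X Y S S' : Spc.{u}} {x : fib F X} {y : fib F Y}
    {a : S ⟶ X} {b : S ⟶ Y} (φ : pull a x ⟶ pull b y) (h : S' ⟶ S) (a' : S' ⟶ X) (b' : S' ⟶ Y)
    (ha : h ≫ a = a') (hb : h ≫ b = b') : pull a' x ⟶ pull b' y :=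
  Pseudofunctor.LocallyDiscreteOpToCat.pullHom φ h a' b' ha hb

/-- `F` is a stack (in groupoids) over the site of topological spaces. -/
structure IsTopStack (F : CatPresheaf.{u, v, w}) : Prop where
  isStack : F.IsStack openCoverTopology.{u}
  isGroupoid : ∀ T : Spc.{u}, IsGroupoid (fib F T)

/-- The square formed by `a : Z ⟶ X`, `b : Z ⟶ Y`, the morphisms `x : X ⟶ F`, `y : Y ⟶ F` and the
2-isomorphism `φ : a^* x ≅ b^* y` is 2-cartesian: `Z` is the fibre product of `X` and `Y` over `F`.
(Since `X` and `Y` are spaces, the fibre product has only identity morphisms, and it is the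
presheaf of sets whose sections over `S` are the triples `(a', b', φ')`.) -/
def IsFiberProduct {F : CatPresheaf.{u, v, w}} {X Y Z : Spc.{u}} (x : fib F X) (y : fib F Y)
    (a : Z ⟶ X) (b : Z ⟶ Y) (φ : pull a x ≅ pull b y) : Prop :=
  ∀ (S : Spc.{u}) (a' : S ⟶ X) (b' : S ⟶ Y) (φ' : pull a' x ≅ pull b' y),
    ∃! h : S ⟶ Z, ∃ (ha : h ≫ a = a') (hb : h ≫ b = b'), pullMor φ.hom h a' b' ha hb = φ'.hom

/-- The morphism `x : X ⟶ F` is representable: for every morphism `y : T ⟶ F` from a space, the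
fibre product of `X` and `T` over `F` is a space. -/
def IsRepresentable {F : CatPresheaf.{u, v, w}} {X : Spc.{u}} (x : fib F X) : Prop :=
  ∀ (T : Spc.{u}) (y : fib F T), ∃ (Z : Spc.{u}) (a : Z ⟶ X) (b : Z ⟶ T)
    (φ : pull a x ≅ pull b y), IsFiberProduct x y a b φ

/-- The morphism `x : X ⟶ F` is an epimorphism of stacks: every morphism `y : T ⟶ F` from a space
lifts to `X`, up to a 2-isomorphism, on an open neighbourhood of every point of `T`. -/
def IsEpimorphism {F : CatPresheaf.{u, v, w}} {X : Spc.{u}} (x : fib F X) : Prop :=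
  ∀ (T : Spc.{u}) (y : fib F T) (t : T), ∃ (U : Spc.{u}) (i : U ⟶ T),
    Topology.IsOpenEmbedding i ∧ t ∈ Set.range i ∧
      ∃ a : U ⟶ X, Nonempty (pull a x ≅ pull i y)

/-- The diagonal of `F` is representable: for every morphism `(y, z) : T ⟶ F × F` from a space,
the fibre product of `T` and `F` over `F × F`, which is the presheaf over `T` of isomorphisms from
`y` to `z`, is a space. -/
def HasRepresentableDiagonal (F : CatPresheaf.{u, v, w}) : Prop :=
  ∀ (T : Spc.{u}) (y z : fib F T), ∃ (Z : Spc.{u}) (b : Z ⟶ T) (ψ : pull b y ≅ pull b z),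
    ∀ (S : Spc.{u}) (b' : S ⟶ T) (ψ' : pull b' y ≅ pull b' z),
      ∃! h : S ⟶ Z, ∃ hb : h ≫ b = b', pullMor ψ.hom h b' b' hb hb = ψ'.hom

/-- A pretopological stack: a stack over the site of topological spaces that admits a representable
epimorphism from a topological space. -/
structure IsPretopological (F : CatPresheaf.{u, v, w}) : Prop where
  isTopStack : IsTopStack F
  exists_chart : ∃ (X : Spc.{u}) (x : fib F X), IsRepresentable x ∧ IsEpimorphism x

/-- The mapping stack from the space `A` to the stack `F`. Its value at `T` is the groupoid
`F(T × A)` of morphisms `T × A ⟶ F`. -/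
def mappingStack (A : Spc.{u}) (F : CatPresheaf.{u, v, w}) : CatPresheaf.{u, v, w} :=
  (prodRight A).op.toPseudofunctor.comp F

/-! ### Topological groupoids and presentations -/

/-- A topological groupoid, internal to compactly generated spaces. The composite of `g : x ⟶ y`
and `h : y ⟶ z` is `comp (g, h)`. -/
structure TopGroupoid where
  /-- The space of objects. -/
  obj : Spc.{u}
  /-- The space of arrows. -/
  arr : Spc.{u}
  src : arr ⟶ obj
  tgt : arr ⟶ obj
  unit : obj ⟶ arr
  inv : arr ⟶ arr
  comp : pb tgt src ⟶ arr
  src_unit : ∀ x, src (unit x) = x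
  tgt_unit : ∀ x, tgt (unit x) = x
  src_inv : ∀ g, src (inv g) = tgt g
  tgt_inv : ∀ g, tgt (inv g) = src g
  src_comp : ∀ g h (e : tgt g = src h), src (comp (pb.mk g h e)) = src g
  tgt_comp : ∀ g h (e : tgt g = src h), tgt (comp (pb.mk g h e)) = tgt h
  unit_comp : ∀ g, comp (pb.mk (unit (src g)) g (tgt_unit _)) = g
  comp_unit : ∀ g, comp (pb.mk g (unit (tgt g)) (src_unit _).symm) = g
  comp_assoc : ∀ f g h (e : tgt f = src g) (e' : tgt g = src h),
    comp (pb.mk (comp (pb.mk f g e)) h ((tgt_comp f g e).trans e')) =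
      comp (pb.mk f (comp (pb.mk g h e')) (e.trans (src_comp g h e').symm))
  inv_comp : ∀ g, comp (pb.mk (inv g) g (tgt_inv g)) = unit (tgt g)
  comp_inv : ∀ g, comp (pb.mk g (inv g) (src_inv g).symm) = unit (src g)

/-- A groupoid presentation of the stack `F` by the topological groupoid `Γ`, that is, an
identification of `F` with the quotient stack of `Γ`: an epimorphism `chart : Γ.obj ⟶ F` together
with a 2-isomorphism `φ` that identifies `Γ.arr` with the fibre product of `Γ.obj` with itself over
`F` in such a way that composition in `Γ` corresponds to composition of isomorphisms in `F`. -/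
structure Presentation (F : CatPresheaf.{u, v, w}) (Γ : TopGroupoid.{u}) where
  chart : fib F Γ.obj
  epi : IsEpimorphism chart
  φ : pull Γ.src chart ≅ pull Γ.tgt chart
  cartesian : IsFiberProduct chart chart Γ.src Γ.tgt φ
  cocycle : ∀ (T : Spc.{u}) (g h gh : T ⟶ Γ.arr) (e : ∀ t, Γ.tgt (g t) = Γ.src (h t))
    (_ : ∀ t, gh t = Γ.comp (pb.mk (g t) (h t) (e t)))
    (a b c : T ⟶ Γ.obj) (hga : g ≫ Γ.src = a) (hgb : g ≫ Γ.tgt = b) (hhb : h ≫ Γ.src = b)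
    (hhc : h ≫ Γ.tgt = c) (hgha : gh ≫ Γ.src = a) (hghc : gh ≫ Γ.tgt = c),
    pullMor φ.hom gh a c hgha hghc = pullMor φ.hom g a b hga hgb ≫ pullMor φ.hom h b c hhb hhc

/-- The disjoint union of a family of open subsets of `A`. -/
def coverSpace (A : Spc.{u}) (α : Set (Opens A)) : Spc.{u} :=
  CompactlyGenerated.of.{u, u} (Σ U : α, (U : Opens A))

/-- The natural map from the disjoint union of the open subsets to `A`. -/
def coverMap (A : Spc.{u}) (α : Set (Opens A)) : coverSpace A α ⟶ A :=
  mkHom (X := coverSpace A α) (fun p => p.2.1)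
    (continuous_sigma fun _ => continuous_subtype_val)

/-- The groupoid of a family `α` of open subsets of `A`. Its objects form the disjoint union
`U_α` of the members of `α`, and its arrows form `U_α ×_A U_α`. -/
def coverGroupoid (A : Spc.{u}) (α : Set (Opens A)) : TopGroupoid.{u} where
  obj := coverSpace A α
  arr := pb (coverMap A α) (coverMap A α)
  src := pb.fst _ _
  tgt := pb.snd _ _
  unit := pb.lift (𝟙 _) (𝟙 _) (fun _ => rfl)
  inv := pb.lift (pb.snd _ _) (pb.fst _ _) (fun p => (pb.condition _ _ p).symm)
  comp := pb.lift (pb.fst _ _ ≫ pb.fst _ _) (pb.snd _ _ ≫ pb.snd _ _) (fun p =>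
    (pb.condition _ _ (pb.fst _ _ p)).trans
      ((congrArg (coverMap A α) (pb.condition _ _ p)).trans
        (pb.condition _ _ (pb.snd (pb.snd (coverMap A α) (coverMap A α))
          (pb.fst (coverMap A α) (coverMap A α)) p))))
  src_unit _ := rfl
  tgt_unit _ := rfl
  src_inv _ := rfl
  tgt_inv _ := rfl
  src_comp _ _ _ := rfl
  tgt_comp _ _ _ := rfl
  unit_comp _ := rfl
  comp_unit _ := rfl
  comp_assoc _ _ _ _ _ := rfl
  inv_comp _ := rfl
  comp_inv _ := rfl

/-- The continuous groupoid morphisms `Y ⟶ X`. -/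
structure GroupoidHom (Y X : TopGroupoid.{u}) where
  onArr : C(Y.arr, X.arr)
  onObj : C(Y.obj, X.obj)
  src_eq : ∀ g, X.src (onArr g) = onObj (Y.src g)
  tgt_eq : ∀ g, X.tgt (onArr g) = onObj (Y.tgt g)
  comp_eq : ∀ g h (e : Y.tgt g = Y.src h), onArr (Y.comp (pb.mk g h e)) =
    X.comp (pb.mk (onArr g) (onArr h)
      ((tgt_eq g).trans ((congrArg onObj e).trans (src_eq h).symm)))

/-- The topology of a subspace of `C(Y.arr, X.arr) × C(Y.obj, X.obj)`, where the mapping spaces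
carry the compact-open topology. -/
instance (Y X : TopGroupoid.{u}) : TopologicalSpace (GroupoidHom Y X) :=
  TopologicalSpace.induced (fun f => (f.onArr, f.onObj)) inferInstance

theorem GroupoidHom.continuous_pair (Y X : TopGroupoid.{u}) :
    Continuous (fun f : GroupoidHom Y X => (f.onArr, f.onObj)) :=
  continuous_induced_dom

/-- The space of groupoid morphisms `Y ⟶ X`, as a compactly generated space (for `Y` with
Hausdorff spaces of objects and arrows). -/
def homSpace (Y X : TopGroupoid.{u}) : Spc.{u} := kify (GroupoidHom Y X)

theorem continuous_evaluation {H : Type u} [TopologicalSpace H] {P Q : Spc.{u}} (F : H → C(P, Q))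
    (hF : Continuous F) :
    Continuous (fun p : prod (kify H) P => F (kify.val (kify.val p).1) (kify.val p).2) := by
  refine kify.continuous_of_compHaus (X := kify H × P) _ (fun S g => ?_)
  have h1 : Continuous (fun s : S => F (kify.val (g s).1)) :=
    hF.comp (kify.continuous_val.comp (continuous_fst.comp g.continuous))
  let g2 : C(S, P) := ⟨fun s => (g s).2, continuous_snd.comp g.continuous⟩
  have h2 : Continuous (fun s : S => (F (kify.val (g s).1)).comp g2) :=
    (ContinuousMap.continuous_precomp g2).comp h1
  have := locallyCompactSpace_compHaus S
  exact (continuous_eval (F := C(S, Q))).comp (h2.prodMk continuous_id)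

/-- The universal family of groupoid morphisms, on objects. -/
def evObj (Y X : TopGroupoid.{u}) : prod (homSpace Y X) Y.obj ⟶ X.obj :=
  mkHom _ (continuous_evaluation (H := GroupoidHom Y X) (fun f => f.onObj)
    (continuous_snd.comp (GroupoidHom.continuous_pair Y X)))

/-- The universal family of groupoid morphisms, on arrows. -/
def evArr (Y X : TopGroupoid.{u}) : prod (homSpace Y X) Y.arr ⟶ X.arr :=
  mkHom _ (continuous_evaluation (H := GroupoidHom Y X) (fun f => f.onArr)
    (continuous_fst.comp (GroupoidHom.continuous_pair Y X)))

theorem evArr_src (Y X : TopGroupoid.{u}) :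
    evArr Y X ≫ X.src = prod.map (𝟙 _) Y.src ≫ evObj Y X := by
  ext p
  exact GroupoidHom.src_eq (kify.val (kify.val p).1) (kify.val p).2

theorem evArr_tgt (Y X : TopGroupoid.{u}) :
    evArr Y X ≫ X.tgt = prod.map (𝟙 _) Y.tgt ≫ evObj Y X := by
  ext p
  exact GroupoidHom.tgt_eq (kify.val (kify.val p).1) (kify.val p).2

theorem coverGroupoid_condition (T A : Spc.{u}) (α : Set (Opens A)) :
    prod.map (𝟙 T) (coverGroupoid A α).tgt ≫ prod.map (𝟙 T) (coverMap A α) =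
      prod.map (𝟙 T) (coverGroupoid A α).src ≫ prod.map (𝟙 T) (coverMap A α) := by
  ext p
  exact congrArg (prod.mk (kify.val p).1) (pb.condition _ _ (kify.val p).2).symm

/-- Let `R` be the space of groupoid morphisms from the groupoid of the open cover `α` of `A` to
`Γ`. The morphism `ρ : R × A ⟶ F` is the one given by the universal groupoid morphism
`R × A_α ⟶ Γ` and the presentation `P` of `F` by `Γ`: there is a 2-isomorphism `θ` from the
restriction of `ρ` to `R × U_α` to the composite `R × U_α ⟶ Γ.obj ⟶ F` whose two pullbacks to
`R × (U_α ×_A U_α)` differ by the pullback of `P.φ` along `R × (U_α ×_A U_α) ⟶ Γ.arr`. -/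
def IsUniversalMorphism {F : CatPresheaf.{u, v, w}} {Γ : TopGroupoid.{u}} (P : Presentation F Γ)
    (A : Spc.{u}) (α : Set (Opens A))
    (ρ : fib F (prod (homSpace (coverGroupoid A α) Γ) A)) : Prop :=
  ∃ θ : pull (prod.map (𝟙 _) (coverMap A α)) ρ ≅ pull (evObj (coverGroupoid A α) Γ) P.chart,
    pullMor θ.hom (prod.map (𝟙 _) (coverGroupoid A α).src)
        (prod.map (𝟙 _) (coverGroupoid A α).src ≫ prod.map (𝟙 _) (coverMap A α))
        (evArr (coverGroupoid A α) Γ ≫ Γ.src) rfl (evArr_src _ _).symm ≫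
      pullMor P.φ.hom (evArr (coverGroupoid A α) Γ) (evArr (coverGroupoid A α) Γ ≫ Γ.src)
        (evArr (coverGroupoid A α) Γ ≫ Γ.tgt) rfl rfl =
    pullMor θ.hom (prod.map (𝟙 _) (coverGroupoid A α).tgt)
      (prod.map (𝟙 _) (coverGroupoid A α).src ≫ prod.map (𝟙 _) (coverMap A α))
      (evArr (coverGroupoid A α) Γ ≫ Γ.tgt) (coverGroupoid_condition _ A α) (evArr_tgt _ _).symm

/-- The finite open covers of `A`. -/
def FiniteOpenCover (A : Spc.{u}) : Type u :=
  {α : Set (Opens A) // α.Finite ∧ sSup α = ⊤}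

/-- The disjoint union, over all finite open covers `α` of `A`, of the spaces of groupoid morphisms
from the groupoid of `α` to `Γ`. -/
def coverHomSpace (A : Spc.{u}) (Γ : TopGroupoid.{u}) : Spc.{u} :=
  CompactlyGenerated.of.{u, u} (Σ α : FiniteOpenCover A, homSpace (coverGroupoid A α.1) Γ)

/-- The inclusion of the summand with index `α`. -/
def coverHomSpaceIncl (A : Spc.{u}) (Γ : TopGroupoid.{u}) (α : FiniteOpenCover A) :
    homSpace (coverGroupoid A α.1) Γ ⟶ coverHomSpace A Γ :=
  mkHom (Y := coverHomSpace A Γ)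
    (fun f => (⟨α, f⟩ : Σ α : FiniteOpenCover A, homSpace (coverGroupoid A α.1) Γ))
    (continuous_sigmaMk (σ := fun α : FiniteOpenCover A =>
      (homSpace (coverGroupoid A α.1) Γ : Type u)) (i := α))

end PretopStack

/-! By the 2-Yoneda lemma everything concerns objects and isomorphisms of the groupoids `F(T × A)`.

The mapping stack is a stack because `T ↦ T × A` preserves covers. The overlaps of the cover
multiplied by `A` are more general than products, but every map into `T × A` factors through a
product map by means of the graph of its second component (`pullMor_eq_of_prod_map`).

Diagonals come next. For `y`, `z` over `T`, the sheaf of isomorphisms becomes a space after pullback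
along a map `P ⟶ T` obtained from a chart. This map has local sections but is not an open cover.
Dividing the space over `P` by equality of values at points gives a space over `T` that represents
the sheaf (`RepresentsHomAlong.exists_space`). Applied over `T × A`, this gives a space `Z₀ ⟶ T ×
A`; its sections over the slices `{t} × A` form a subspace of `Map(A, Z₀) × T`, which represents the
diagonal of the mapping stack. Over a stack with representable diagonal every morphism from a space
is representable, so only the epimorphism remains to be produced.

A universal groupoid morphism is a cocycle for the cover of `R × A` by the `R_α × U_α`, with values
in the presentation; descent turns it into an object `r` over `R × A`
(`Presentation.exists_universal`). Conversely, an object `y` over `T × A` lifts to the chart locally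
on `T × A`. As `A` is compact, near `{t} × A` finitely many boxes `V × U` suffice
(`IsCover.exists_section_coverSpace`), and comparing the lifts on overlaps gives a family of
groupoid morphisms over `V` (`Presentation.exists_family`). The objects `r` and `y` then have the
same transition arrows, so their local identifications glue.

Since `A` is locally compact Hausdorff, the compactly generated product with `A` is the ordinary
product and the exponential law holds. Hausdorffness also makes `U_α ×_A U_α` closed in `U_α × U_α`,
so the same is true of the arrows of the cover groupoid. -/

namespace PretopStack

/-! ### Pullback of 2-morphisms along maps of spaces -/

section Calculus

open Pseudofunctor Pseudofunctor.LocallyDiscreteOpToCat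

variable {F : CatPresheaf.{u, v, w}}

/-- The endpoints of `pullMor` are separate arguments tied to the composites by equations. This
keeps pullbacks of composable 2-morphisms composable without transport along equalities of maps. -/
theorem pullMor_comp {X Y Z S S' : Spc.{u}} {x : fib F X} {y : fib F Y} {z : fib F Z}
    {a : S ⟶ X} {b : S ⟶ Y} {c : S ⟶ Z} (φ : pull a x ⟶ pull b y) (ψ : pull b y ⟶ pull c z)
    (h : S' ⟶ S) (a' : S' ⟶ X) (b' : S' ⟶ Y) (c' : S' ⟶ Z)
    (ha : h ≫ a = a') (hb : h ≫ b = b') (hc : h ≫ c = c') :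
    pullMor (φ ≫ ψ) h a' c' ha hc = pullMor φ h a' b' ha hb ≫ pullMor ψ h b' c' hb hc := by
  simp [pullMor, pullHom]

theorem pullMor_id {X S S' : Spc.{u}} {x : fib F X} {a : S ⟶ X}
    (h : S' ⟶ S) (a' : S' ⟶ X) (ha : h ≫ a = a') :
    pullMor (𝟙 (pull a x)) h a' a' ha ha = 𝟙 _ := by
  simp [pullMor, pullHom]

theorem pullMor_pullMor {X Y S S' S'' : Spc.{u}} {x : fib F X} {y : fib F Y}
    {a : S ⟶ X} {b : S ⟶ Y} (φ : pull a x ⟶ pull b y) (h : S' ⟶ S) (a' : S' ⟶ X) (b' : S' ⟶ Y)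
    (ha : h ≫ a = a') (hb : h ≫ b = b') (k : S'' ⟶ S') (a'' : S'' ⟶ X) (b'' : S'' ⟶ Y)
    (ha' : k ≫ a' = a'') (hb' : k ≫ b' = b'') :
    pullMor (pullMor φ h a' b' ha hb) k a'' b'' ha' hb' =
      pullMor φ (k ≫ h) a'' b'' (by rw [Category.assoc, ha, ha'])
        (by rw [Category.assoc, hb, hb']) :=
  pullHom_pullHom φ h a' b' k a'' b'' ha hb ha' hb'

theorem pullMor_congr {X Y S S' : Spc.{u}} {x : fib F X} {y : fib F Y}
    {a : S ⟶ X} {b : S ⟶ Y} (φ : pull a x ⟶ pull b y) {h h' : S' ⟶ S} (e : h = h') (a' : S' ⟶ X)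
    (b' : S' ⟶ Y) (ha : h ≫ a = a') (hb : h ≫ b = b') :
    pullMor φ h a' b' ha hb = pullMor φ h' a' b' (by rw [← e, ha]) (by rw [← e, hb]) := by
  subst e
  rfl

theorem pullMor_eq_change {X Y S₁ S₂ S' : Spc.{u}} {x : fib F X} {y : fib F Y}
    {a₁ : S₁ ⟶ X} {b₁ : S₁ ⟶ Y} {φ₁ : pull a₁ x ⟶ pull b₁ y} {h₁ : S' ⟶ S₁}
    {a₂ : S₂ ⟶ X} {b₂ : S₂ ⟶ Y} {φ₂ : pull a₂ x ⟶ pull b₂ y} {h₂ : S' ⟶ S₂}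
    {a' : S' ⟶ X} {b' : S' ⟶ Y} {ha₁ : h₁ ≫ a₁ = a'} {hb₁ : h₁ ≫ b₁ = b'}
    {ha₂ : h₂ ≫ a₂ = a'} {hb₂ : h₂ ≫ b₂ = b'}
    (e : pullMor φ₁ h₁ a' b' ha₁ hb₁ = pullMor φ₂ h₂ a' b' ha₂ hb₂) {a'' : S' ⟶ X} {b'' : S' ⟶ Y}
    (ha : a' = a'') (hb : b' = b'') :
    pullMor φ₁ h₁ a'' b'' (ha₁.trans ha) (hb₁.trans hb) =
      pullMor φ₂ h₂ a'' b'' (ha₂.trans ha) (hb₂.trans hb) := by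
  subst ha hb
  exact e

theorem pullMor_self {X Y S : Spc.{u}} {x : fib F X} {y : fib F Y}
    {a : S ⟶ X} {b : S ⟶ Y} (φ : pull a x ⟶ pull b y) (h : S ⟶ S) (e : h = 𝟙 S)
    (ha : h ≫ a = a) (hb : h ≫ b = b) : pullMor φ h a b ha hb = φ := by
  subst e
  exact pullHom_id φ

theorem pullMor_comp_of_eq {X Y S S' S'' : Spc.{u}} {x : fib F X} {y : fib F Y}
    {a : S ⟶ X} {b : S ⟶ Y} {φ : pull a x ⟶ pull b y} {h : S' ⟶ S} {a' : S' ⟶ X} {b' : S' ⟶ Y}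
    {ha : h ≫ a = a'} {hb : h ≫ b = b'} {ψ : pull a' x ⟶ pull b' y}
    (e : pullMor φ h a' b' ha hb = ψ) (k : S'' ⟶ S') {l : S'' ⟶ S} (hl : k ≫ h = l)
    (a'' : S'' ⟶ X) (b'' : S'' ⟶ Y) (ha' : k ≫ a' = a'') (hb' : k ≫ b' = b'') (ha'' : l ≫ a = a'')
    (hb'' : l ≫ b = b'') :
    pullMor φ l a'' b'' ha'' hb'' = pullMor ψ k a'' b'' ha' hb' := by
  subst e hl
  exact (pullMor_pullMor _ _ _ _ _ _ _ _ _ _ _).symm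

/-- Pullback of 2-isomorphisms. -/
def pullIso {X Y S S' : Spc.{u}} {x : fib F X} {y : fib F Y}
    {a : S ⟶ X} {b : S ⟶ Y} (φ : pull a x ≅ pull b y)
    (h : S' ⟶ S) (a' : S' ⟶ X) (b' : S' ⟶ Y) (ha : h ≫ a = a') (hb : h ≫ b = b') :
    pull a' x ≅ pull b' y where
  hom := pullMor φ.hom h a' b' ha hb
  inv := pullMor φ.inv h b' a' hb ha
  hom_inv_id := by rw [← pullMor_comp, φ.hom_inv_id, pullMor_id]
  inv_hom_id := by rw [← pullMor_comp, φ.inv_hom_id, pullMor_id]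

/-- The canonical isomorphism `f^* a^* x ≅ (f ≫ a)^* x`. -/
def pullPull {X W S : Spc.{u}} (f : S ⟶ W) (a : W ⟶ X) (fa : S ⟶ X) (h : f ≫ a = fa)
    (x : fib F X) : pull f (pull a x) ≅ pull fa x :=
  (Cat.Hom.toNatIso (F.mapComp' a.op.toLoc f.op.toLoc fa.op.toLoc (by subst h; rfl))).symm.app x

theorem map_eq_conj {X Y S S' : Spc.{u}} {x : fib F X} {y : fib F Y}
    {a : S ⟶ X} {b : S ⟶ Y} (φ : pull a x ⟶ pull b y) (h : S' ⟶ S) (a' : S' ⟶ X) (b' : S' ⟶ Y)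
    (ha : h ≫ a = a') (hb : h ≫ b = b') :
    (F.map h.op.toLoc).toFunctor.map φ =
      (pullPull h a a' ha x).hom ≫ pullMor φ h a' b' ha hb ≫ (pullPull h b b' hb y).inv :=
  map_eq_pullHom φ h a' b' ha hb

theorem pullMor_eq_conj {X Y S S' : Spc.{u}} {x : fib F X} {y : fib F Y}
    {a : S ⟶ X} {b : S ⟶ Y} (φ : pull a x ⟶ pull b y) (h : S' ⟶ S) (a' : S' ⟶ X) (b' : S' ⟶ Y)
    (ha : h ≫ a = a') (hb : h ≫ b = b') :
    pullMor φ h a' b' ha hb =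
      (pullPull h a a' ha x).inv ≫ (F.map h.op.toLoc).toFunctor.map φ ≫ (pullPull h b b' hb y).hom :=
  rfl

/-- Pulling back is compatible with the identifications `f^* a^* x ≅ (f ≫ a)^* x`. -/
theorem pullMor_pullPull {X W S S' : Spc.{u}} (f : S ⟶ W) (a : W ⟶ X) (fa : S ⟶ X) (h : f ≫ a = fa)
    (x : fib F X) (k : S' ⟶ S) (kf : S' ⟶ W) (kfa : S' ⟶ X) (h1 : k ≫ f = kf) (h2 : k ≫ fa = kfa) :
    pullMor (F := F) (x := pull a x) (pullPull f a fa h x).hom k kf kfa h1 h2 =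
      (pullPull kf a kfa (by rw [← h1, ← h2, ← h, Category.assoc]) x).hom := by
  subst h h1
  obtain rfl : k ≫ f ≫ a = kfa := h2
  -- Associativity coherence of the pseudofunctor for the three maps `k`, `f`, `a`.
  have e := F.mapComp'_inv_whiskerRight_mapComp'₀₂₃_inv_app a.op.toLoc f.op.toLoc k.op.toLoc
    (f ≫ a).op.toLoc (k ≫ f).op.toLoc (k ≫ f ≫ a).op.toLoc rfl rfl rfl x
  exact (congrArg (fun m => (F.mapComp' f.op.toLoc k.op.toLoc (k ≫ f).op.toLoc rfl).hom.toNatTrans.app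
    (pull a x) ≫ m) e).trans (Cat.Hom.hom_inv_id_toNatTrans_app_assoc _ _ _)

theorem pullMor_pullPull_inv {X W S S' : Spc.{u}} (f : S ⟶ W) (a : W ⟶ X) (fa : S ⟶ X)
    (h : f ≫ a = fa) (x : fib F X) (k : S' ⟶ S) (kf : S' ⟶ W) (kfa : S' ⟶ X) (h1 : k ≫ f = kf)
    (h2 : k ≫ fa = kfa) :
    pullMor (F := F) (y := pull a x) (pullPull f a fa h x).inv k kfa kf h2 h1 =
      (pullPull kf a kfa (by rw [← h1, ← h2, ← h, Category.assoc]) x).inv := by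
  rw [← cancel_epi (pullPull kf a kfa (by rw [← h1, ← h2, ← h, Category.assoc]) x).hom,
    Iso.hom_inv_id, ← pullMor_pullPull f a fa h x k kf kfa h1 h2, ← pullMor_comp, Iso.hom_inv_id,
    pullMor_id]

theorem pullMor_pullPull_comp {X Y W S S' : Spc.{u}} (f : S ⟶ W) (a : W ⟶ X) (fa : S ⟶ X)
    (h : f ≫ a = fa) {x : fib F X} {y : fib F Y} {b : S ⟶ Y} (ψ : pull fa x ⟶ pull b y)
    (k : S' ⟶ S) (kf : S' ⟶ W) (kfa : S' ⟶ X) (kb : S' ⟶ Y) (h1 : k ≫ f = kf) (h2 : k ≫ fa = kfa)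
    (h3 : k ≫ b = kb) :
    pullMor (F := F) (x := pull a x) ((pullPull f a fa h x).hom ≫ ψ) k kf kb h1 h3 =
      (pullPull kf a kfa (by rw [← h1, ← h2, ← h, Category.assoc]) x).hom ≫
        pullMor ψ k kfa kb h2 h3 :=
  (pullMor_comp _ _ _ _ kfa _ _ h2 _).trans
    (congrArg (· ≫ pullMor ψ k kfa kb h2 h3) (pullMor_pullPull _ _ _ _ _ _ _ _ _ _))

end Calculus

/-! ### The structure isomorphisms of the mapping stack -/

section MappingStack

variable {A : Spc.{u}} {F : CatPresheaf.{u, v, w}}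

/-- The functor `T ↦ T × A` preserves composites definitionally, so the structure isomorphism of the
composite pseudofunctor is that of `F` preceded by the image of an identity. -/
theorem mappingStack_mapComp' {S T U : Spc.{u}} (f : S ⟶ T) (g : T ⟶ U) (fg : S ⟶ U)
    (h : f ≫ g = fg) :
    (mappingStack A F).mapComp' g.op.toLoc f.op.toLoc fg.op.toLoc (by subst h; rfl) =
      F.mapComp' (prod.map g (𝟙 A)).op.toLoc (prod.map f (𝟙 A)).op.toLoc
        (prod.map fg (𝟙 A)).op.toLoc (by subst h; rfl) := by
  subst h
  have e : (mappingStack A F).mapComp' g.op.toLoc f.op.toLoc (f ≫ g).op.toLoc rfl =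
    (mappingStack A F).mapComp g.op.toLoc f.op.toLoc := Pseudofunctor.mapComp'_eq_mapComp _ _ _
  rw [e]
  refine Eq.trans ?_ (Pseudofunctor.mapComp'_eq_mapComp F (prod.map g (𝟙 A)).op.toLoc
    (prod.map f (𝟙 A)).op.toLoc).symm
  change F.map₂Iso (Iso.refl _) ≪≫ F.mapComp (prod.map g (𝟙 A)).op.toLoc
    (prod.map f (𝟙 A)).op.toLoc = F.mapComp (prod.map g (𝟙 A)).op.toLoc
    (prod.map f (𝟙 A)).op.toLoc
  have e₂ : F.map₂Iso (Iso.refl ((prod.map g (𝟙 A)).op.toLoc ≫ (prod.map f (𝟙 A)).op.toLoc)) =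
    Iso.refl _ := Iso.ext (F.map₂_id _)
  exact (congrArg (· ≪≫ F.mapComp (prod.map g (𝟙 A)).op.toLoc
    (prod.map f (𝟙 A)).op.toLoc) e₂).trans (Iso.refl_trans _)

/-- The pullback of 2-morphisms for the mapping stack. -/
theorem pullMor_mappingStack {X Y S S' : Spc.{u}} {x : fib (mappingStack A F) X}
    {y : fib (mappingStack A F) Y} {a : S ⟶ X} {b : S ⟶ Y} (φ : pull a x ⟶ pull b y)
    (h : S' ⟶ S) (a' : S' ⟶ X) (b' : S' ⟶ Y) (ha : h ≫ a = a') (hb : h ≫ b = b') :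
    pullMor φ h a' b' ha hb =
      pullMor (F := F) (X := prod X A) (Y := prod Y A) (x := x) (y := y)
        (a := prod.map a (𝟙 A)) (b := prod.map b (𝟙 A)) φ (prod.map h (𝟙 A))
        (prod.map a' (𝟙 A)) (prod.map b' (𝟙 A)) (by subst ha; rfl) (by subst hb; rfl) := by
  unfold pullMor Pseudofunctor.LocallyDiscreteOpToCat.pullHom
  rw [mappingStack_mapComp' _ _ _ ha, mappingStack_mapComp' _ _ _ hb]
  rfl

end MappingStack

/-! ### Descent for morphisms and objects -/

section Descent

universe t

variable {F : CatPresheaf.{u, v, w}}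

/-- A family of morphisms that is covering for the topology of open coverings. -/
def IsCover {ι : Type t} {T : Spc.{u}} {W : ι → Spc.{u}} (q : ∀ i, W i ⟶ T) : Prop :=
  Sieve.ofArrows W q ∈ openCoverTopology.{u} T

variable {ι : Type t} {T : Spc.{u}} {W : ι → Spc.{u}} {q : ∀ i, W i ⟶ T}
-- Faithfulness of the functor to descent data.
theorem pull_hom_ext (hF : IsTopStack F) (hq : IsCover q) {X Y : Spc.{u}} {x : fib F X} {y : fib F Y} {a : T ⟶ X} {b : T ⟶ Y}
    (φ ψ : pull a x ⟶ pull b y)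
    (h : ∀ i, pullMor φ (q i) (q i ≫ a) (q i ≫ b) rfl rfl =
      pullMor ψ (q i) (q i ≫ a) (q i ≫ b) rfl rfl) : φ = ψ := by
  have := hF.isStack
  apply (F.fullyFaithfulToDescentData q hq).map_injective
  ext i
  refine (map_eq_conj φ (q i) _ _ rfl rfl).trans (Eq.trans ?_ (map_eq_conj ψ (q i) _ _ rfl rfl).symm)
  rw [h]

/-- Fullness of the functor to descent data. Conjugation by `pullPull` turns the given local
morphisms, which live on `(q i ≫ a)^* x`, into morphisms on the restrictions of `a^* x`; agreement
on overlaps becomes the compatibility square. -/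
theorem exists_glue (hF : IsTopStack F) (hq : IsCover q) {X Y : Spc.{u}} {x : fib F X} {y : fib F Y} {a : T ⟶ X} {b : T ⟶ Y}
    (a' : ∀ i, W i ⟶ X) (b' : ∀ i, W i ⟶ Y) (ha : ∀ i, q i ≫ a = a' i) (hb : ∀ i, q i ≫ b = b' i)
    (φ : ∀ i, pull (a' i) x ⟶ pull (b' i) y)
    (h : ∀ i j (S : Spc.{u}) (f : S ⟶ W i) (g : S ⟶ W j) (r : S ⟶ T) (hf : f ≫ q i = r)
      (hg : g ≫ q j = r),
      pullMor (φ i) f (r ≫ a) (r ≫ b) (by rw [← hf, ← ha, Category.assoc])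
        (by rw [← hf, ← hb, Category.assoc]) =
      pullMor (φ j) g (r ≫ a) (r ≫ b) (by rw [← hg, ← ha, Category.assoc])
        (by rw [← hg, ← hb, Category.assoc])) :
    ∃ ψ : pull a x ⟶ pull b y, ∀ i, pullMor ψ (q i) (a' i) (b' i) (ha i) (hb i) = φ i := by
  have := hF.isStack
  let c : ∀ i, pull (q i) (pull a x) ⟶ pull (q i) (pull b y) := fun i =>
    (pullPull (q i) a (a' i) (ha i) x).hom ≫ φ i ≫ (pullPull (q i) b (b' i) (hb i) y).inv
  have hc : ∀ i (S : Spc.{u}) (f : S ⟶ W i) (r : S ⟶ T) (hf : f ≫ q i = r),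
      pullMor (F := F) (x := pull a x) (y := pull b y) (c i) f r r hf hf =
        (pullPull r a (r ≫ a) rfl x).hom ≫ pullMor (φ i) f (r ≫ a) (r ≫ b)
          (by rw [← hf, ← ha, Category.assoc]) (by rw [← hf, ← hb, Category.assoc]) ≫
          (pullPull r b (r ≫ b) rfl y).inv := by
    intro i S f r hf
    rw [pullMor_comp _ _ f r (r ≫ a) r hf (by rw [← hf, ← ha, Category.assoc]) hf,
      pullMor_comp _ _ f (r ≫ a) (r ≫ b) r (by rw [← hf, ← ha, Category.assoc])
       (by rw [← hf, ← hb, Category.assoc]) hf, pullMor_pullPull, pullMor_pullPull_inv]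
  let d : (F.toDescentData q).obj (pull a x) ⟶ (F.toDescentData q).obj (pull b y) :=
    { hom := c
      comm := by
        intro S r i j f g hf hg
        have e1 : (F.map f.op.toLoc).toFunctor.map (c i) = _ :=
          map_eq_conj (F := F) (x := pull a x) (y := pull b y) (c i) f r r hf hf
        have e2 : (F.map g.op.toLoc).toFunctor.map (c j) = _ :=
          map_eq_conj (F := F) (x := pull a x) (y := pull b y) (c j) g r r hg hg
        have e3 : ∀ z : fib F T, ((F.toDescentData q).obj z).hom r f g hf hg =
          (pullPull f (q i) r hf z).hom ≫ (pullPull g (q j) r hg z).inv := fun _ => rfl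
        rw [e3, e3]
        refine (congrArg (· ≫ (pullPull f (q i) r hf (pull b y)).hom ≫
          (pullPull g (q j) r hg (pull b y)).inv) e1).trans (Eq.trans ?_
          (congrArg (((pullPull f (q i) r hf (pull a x)).hom ≫
            (pullPull g (q j) r hg (pull a x)).inv) ≫ ·) e2).symm)
        rw [hc i, hc j, h i j S f g r hf hg]
        simp }
  refine ⟨(F.fullyFaithfulToDescentData q hq).preimage d, fun i => ?_⟩
  have e : (F.map (q i).op.toLoc).toFunctor.map
      ((F.fullyFaithfulToDescentData q hq).preimage d) = c i :=
    congrArg (fun m => Pseudofunctor.DescentData.Hom.hom m i)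
      ((F.fullyFaithfulToDescentData q hq).map_preimage d)
  rw [pullMor_eq_conj, e]
  simp [c]

/-- Descent of objects: objects that are identified on overlaps by a cocycle come from an object
on the base. -/
theorem exists_descent_object (hF : IsTopStack F) (hq : IsCover q) {X : ι → Spc.{u}}
    (x : ∀ i, fib F (X i)) (a : ∀ i, W i ⟶ X i)
    (m : ∀ i j (S : Spc.{u}) (f : S ⟶ W i) (g : S ⟶ W j), f ≫ q i = g ≫ q j →
      (pull (f ≫ a i) (x i) ⟶ pull (g ≫ a j) (x j)))
    (hm : ∀ i j (S S' : Spc.{u}) (f : S ⟶ W i) (g : S ⟶ W j) (h : f ≫ q i = g ≫ q j) (k : S' ⟶ S),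
      pullMor (m i j S f g h) k ((k ≫ f) ≫ a i) ((k ≫ g) ≫ a j) (Category.assoc _ _ _).symm
        (Category.assoc _ _ _).symm =
      m i j S' (k ≫ f) (k ≫ g) (by rw [Category.assoc, Category.assoc, h]))
    (hc : ∀ i j l (S : Spc.{u}) (f : S ⟶ W i) (g : S ⟶ W j) (e : S ⟶ W l) (h : f ≫ q i = g ≫ q j)
      (h' : g ≫ q j = e ≫ q l), m i j S f g h ≫ m j l S g e h' = m i l S f e (h.trans h')) :
    ∃ (ρ : fib F T) (θ : ∀ i, pull (q i) ρ ≅ pull (a i) (x i)),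
      ∀ i j (S : Spc.{u}) (f : S ⟶ W i) (g : S ⟶ W j) (h : f ≫ q i = g ≫ q j),
        pullMor (θ i).hom f (f ≫ q i) (f ≫ a i) rfl rfl ≫ m i j S f g h =
          pullMor (θ j).hom g (f ≫ q i) (g ≫ a j) h.symm rfl := by
  have := hF.isStack
  -- The cocycle condition makes this morphism idempotent, and an idempotent of a groupoid is an
  -- identity. So no unit condition has to be imposed on `m`.
  have hid : ∀ i (S : Spc.{u}) (f : S ⟶ W i), m i i S f f rfl = 𝟙 _ := by
    intro i S f
    have := hF.isGroupoid S
    rw [← cancel_mono (m i i S f f rfl), hc, Category.id_comp]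
  let D : F.DescentData q :=
    { obj := fun i => pull (a i) (x i)
      hom := fun S r i j f g hf hg => (pullPull f (a i) _ rfl (x i)).hom ≫
        m i j S f g (hf.trans hg.symm) ≫ (pullPull g (a j) _ rfl (x j)).inv
      pullHom_hom := by
        intro S' S k r r' hr i j f g hf hg kf kg hkf hkg
        subst hkf hkg
        refine (pullMor_comp _ _ k (k ≫ f) ((k ≫ f) ≫ a i) (k ≫ g) rfl (Category.assoc _ _ _).symm
          rfl).trans ?_
        rw [pullMor_comp _ _ k ((k ≫ f) ≫ a i) ((k ≫ g) ≫ a j) (k ≫ g) (Category.assoc _ _ _).symm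
          (Category.assoc _ _ _).symm rfl, pullMor_pullPull, pullMor_pullPull_inv, hm]
      hom_self := by
        intro S r i f hf
        rw [hid]
        simp
      hom_comp := by
        intro S r i j l f g e hf hg he
        simp [reassoc_of% hc i j l S f g e (hf.trans hg.symm) (hg.trans he.symm)] }
  have := F.isEquivalence_toDescentData q hq
  let E : (F.toDescentData q).obj ((F.toDescentData q).objPreimage D) ≅ D :=
    (F.toDescentData q).objObjPreimageIso D
  let ρ : fib F T := (F.toDescentData q).objPreimage D
  let θ : ∀ i, pull (q i) ρ ≅ pull (a i) (x i) := fun i =>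
    { hom := E.hom.hom i
      inv := E.inv.hom i
      hom_inv_id := congrArg (fun t => Pseudofunctor.DescentData.Hom.hom t i) E.hom_inv_id
      inv_hom_id := congrArg (fun t => Pseudofunctor.DescentData.Hom.hom t i) E.inv_hom_id }
  refine ⟨ρ, θ, fun i j S f g h => ?_⟩
  have e0 : (F.map f.op.toLoc).toFunctor.map (θ i).hom ≫ (pullPull f (a i) _ rfl (x i)).hom ≫
        m i j S f g h ≫ (pullPull g (a j) _ rfl (x j)).inv =
      ((pullPull f (q i) (f ≫ q i) rfl ρ).hom ≫ (pullPull g (q j) (f ≫ q i) h.symm ρ).inv) ≫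
        (F.map g.op.toLoc).toFunctor.map (θ j).hom :=
    E.hom.comm (f ≫ q i) f g rfl h.symm
  rw [map_eq_conj (θ i).hom f (f ≫ q i) (f ≫ a i) rfl rfl,
    map_eq_conj (θ j).hom g (f ≫ q i) (g ≫ a j) h.symm rfl] at e0
  simp only [Category.assoc, Iso.inv_hom_id_assoc, cancel_epi] at e0
  simpa only [← Category.assoc, cancel_mono] using e0

/-- Gluing of 2-isomorphisms along a cover. -/
theorem exists_glue_iso (hF : IsTopStack F) (hq : IsCover q) {X Y : Spc.{u}} {x : fib F X}
    {y : fib F Y} {a : T ⟶ X} {b : T ⟶ Y}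
    (a' : ∀ i, W i ⟶ X) (b' : ∀ i, W i ⟶ Y) (ha : ∀ i, q i ≫ a = a' i) (hb : ∀ i, q i ≫ b = b' i)
    (φ : ∀ i, pull (a' i) x ⟶ pull (b' i) y)
    (h : ∀ i j (S : Spc.{u}) (f : S ⟶ W i) (g : S ⟶ W j) (r : S ⟶ T) (hf : f ≫ q i = r)
      (hg : g ≫ q j = r),
      pullMor (φ i) f (r ≫ a) (r ≫ b) (by rw [← hf, ← ha, Category.assoc])
        (by rw [← hf, ← hb, Category.assoc]) =
      pullMor (φ j) g (r ≫ a) (r ≫ b) (by rw [← hg, ← ha, Category.assoc])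
        (by rw [← hg, ← hb, Category.assoc])) :
    ∃ ψ : pull a x ≅ pull b y, ∀ i, pullMor ψ.hom (q i) (a' i) (b' i) (ha i) (hb i) = φ i := by
  obtain ⟨ψ, hψ⟩ := exists_glue hF hq a' b' ha hb φ h
  have := hF.isGroupoid T
  exact ⟨asIso ψ, hψ⟩

end Descent

/-! ### Covers as families with local sections -/

section Covers

universe t

/-- A local section factors an open inclusion through the family and so puts it in the generated
sieve. With the converse below, covering families become families with local sections, which need be
neither open nor injective. -/
theorem isCover_of_local_sections {ι : Type t} {T : Spc.{u}} {W : ι → Spc.{u}} {q : ∀ i, W i ⟶ T}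
    (h : ∀ t : T, ∃ (O : Opens T) (_ : t ∈ O) (i : ι)
      (s : CompactlyGenerated.of.{u, u} O ⟶ W i), ∀ o : O, q i (s o) = o.1) :
    IsCover q := by
  intro t
  obtain ⟨O, ht, i, s, hs⟩ := h t
  refine ⟨CompactlyGenerated.of.{u, u} O, mkHom (fun p => p.1) continuous_subtype_val,
    O.isOpen.isOpenEmbedding_subtypeVal, ⟨⟨t, ht⟩, rfl⟩, ?_⟩
  rw [Sieve.mem_ofArrows_iff]
  exact ⟨i, s, by ext o; exact (hs o).symm⟩

theorem IsCover.exists_local_section {ι : Type t} {T : Spc.{u}} {W : ι → Spc.{u}}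
    {q : ∀ i, W i ⟶ T} (h : IsCover q) (t : T) : ∃ (O : Opens T) (_ : t ∈ O) (i : ι)
      (s : CompactlyGenerated.of.{u, u} O ⟶ W i), ∀ o : O, q i (s o) = o.1 := by
  obtain ⟨U, i, hi, ht, hR⟩ := h t
  rw [Sieve.mem_ofArrows_iff] at hR
  obtain ⟨k, s, hs⟩ := hR
  let e := hi.isEmbedding.toHomeomorph
  refine ⟨⟨Set.range i, hi.isOpen_range⟩, ht, k, mkHom (fun p => s (e.symm p))
    ((continuous_hom s).comp e.symm.continuous), fun o => ?_⟩
  have h1 : q k (s (e.symm o)) = i (e.symm o) := congrArg (fun m => m (e.symm o)) hs.symm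
  exact h1.trans (congrArg Subtype.val (e.apply_symm_apply o))

/-- A family of open subsets that covers the space. -/
theorem isCover_opens {ι : Type t} {T : Spc.{u}} (O : ι → Opens T) (h : ∀ t : T, ∃ i, t ∈ O i) :
    IsCover (W := fun i => CompactlyGenerated.of.{u, u} (O i))
      (fun _ => mkHom (fun p => p.1) continuous_subtype_val) := by
  refine isCover_of_local_sections fun t => ?_
  obtain ⟨i, hi⟩ := h t
  exact ⟨O i, hi, i, 𝟙 _, fun _ => rfl⟩

end Covers

/-! ### Products with a locally compact Hausdorff factor and the exponential law -/

section Topology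

theorem uCompactlyGeneratedSpace_of_locallyCompact (X : Type u) [TopologicalSpace X]
    [LocallyCompactSpace X] [T2Space X] : UCompactlyGeneratedSpace.{u} X :=
  inferInstanceAs (CompactlyGeneratedSpace X)

/-- The product topology with a locally compact Hausdorff space is compactly generated. -/
theorem prod.continuous_mk (X Y : Spc.{u}) [LocallyCompactSpace Y] [T2Space Y] :
    Continuous (fun p : X × Y => (prod.mk p.1 p.2 : prod X Y)) := by
  have key : ∀ W : Set (prod X Y), IsOpen W →
      IsOpen ((fun p : X × Y => (prod.mk p.1 p.2 : prod X Y)) ⁻¹' W) := by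
    intro W hW
    rw [isOpen_iff_mem_nhds]
    rintro ⟨x, y⟩ hxy
    have hslice : Continuous (fun y' : Y => (prod.mk x y' : prod X Y)) :=
      kify.continuous_mk_comp (X := X × Y) (fun y' => (x, y')) (by fun_prop)
    obtain ⟨K, hKy, hKW, hK⟩ := local_compact_nhds ((hW.preimage hslice).mem_nhds hxy)
    have : CompactSpace K := isCompact_iff_compactSpace.1 hK
    -- Tube lemma tested on compact Hausdorff spaces `S`. The complement pulls back to the
    -- projection to `S` of a closed subset of `S × K`, and this projection is closed since `K` is
    -- compact. The ordinary product `S × K` is already compactly generated, so it maps continuously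
    -- to `prod X Y`.
    have hV : IsOpen {x' : X | ∀ k ∈ K, (prod.mk x' k : prod X Y) ∈ W} := by
      refine UCompactlyGeneratedSpace.isOpen.{u} fun S g => ?_
      have := locallyCompactSpace_compHaus S
      have : LocallyCompactSpace K := inferInstance
      have := uCompactlyGeneratedSpace_of_locallyCompact (S × K)
      have hc : Continuous (fun p : CompactlyGenerated.of.{u, u} (S × K) =>
          (prod.mk (g p.1) p.2.1 : prod X Y)) :=
        kify.continuous_mk_comp (X := X × Y) (T := CompactlyGenerated.of.{u, u} (S × K))
          (fun p => (g p.1, p.2.1)) (by fun_prop)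
      have hcl : IsClosed (Prod.fst '' ((fun p : S × K =>
          (prod.mk (g p.1) p.2.1 : prod X Y)) ⁻¹' Wᶜ)) :=
        isClosedMap_fst_of_compactSpace _ ((hW.isClosed_compl).preimage hc)
      rw [← isClosed_compl_iff]
      convert hcl using 1
      ext s
      constructor
      · intro h
        simp only [Set.mem_compl_iff, Set.mem_preimage, Set.mem_ofPred_eq, not_forall] at h
        obtain ⟨k, hk, h⟩ := h
        exact ⟨(s, ⟨k, hk⟩), h, rfl⟩
      · rintro ⟨⟨s', k⟩, h, rfl⟩ h'
        exact h (h' k.1 k.2)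
    refine Filter.mem_of_superset (prod_mem_nhds (hV.mem_nhds
      (show x ∈ {x' : X | ∀ k ∈ K, (prod.mk x' k : prod X Y) ∈ W} from fun k hk => hKW hk)) hKy) ?_
    rintro ⟨x', y'⟩ ⟨h1, h2⟩
    exact h1 y' h2
  exact ⟨key⟩

/-- The exponential transpose. -/
theorem continuous_curry {T Y X : Spc.{u}} [LocallyCompactSpace Y] [T2Space Y] (f : prod T Y ⟶ X)
    (F : T → C(Y, X)) (hF : ∀ t y, F t y = f (prod.mk t y)) : Continuous F := by
  have h : F = (ContinuousMap.curry ⟨fun p : T × Y => f (prod.mk p.1 p.2),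
      (continuous_hom f).comp (prod.continuous_mk T Y)⟩) := by
    ext t y
    exact hF t y
  rw [h]
  exact ContinuousMap.continuous _

/-- A locally compact Hausdorff space carries its compactly generated topology. -/
def kify.homeomorph (X : Type u) [TopologicalSpace X] [LocallyCompactSpace X] [T2Space X] :
    kify X ≃ₜ X where
  toFun := kify.val
  invFun := kify.mk
  left_inv _ := rfl
  right_inv _ := rfl
  continuous_toFun := kify.continuous_val
  continuous_invFun :=
    have := uCompactlyGeneratedSpace_of_locallyCompact X
    kify.continuous_mk_comp (T := CompactlyGenerated.of.{u, u} X)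
    (fun x => x) continuous_id

end Topology

section ProductCover

universe t

theorem IsCover.prod_map {ι : Type t} {T A : Spc.{u}} {W : ι → Spc.{u}} {q : ∀ i, W i ⟶ T}
    (h : IsCover q) : IsCover (fun i => prod.map (q i) (𝟙 A)) := by
  refine isCover_of_local_sections fun p => ?_
  obtain ⟨O, hO, i, s, hs⟩ := h.exists_local_section (prod.fst T A p)
  let O' : Opens (prod T A) := ⟨prod.fst T A ⁻¹' O, O.isOpen.preimage (continuous_hom _)⟩
  let j : CompactlyGenerated.of.{u, u} O' ⟶ prod T A := mkHom (fun p => p.1) continuous_subtype_val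
  let k : CompactlyGenerated.of.{u, u} O' ⟶ CompactlyGenerated.of.{u, u} O :=
    mkHom (fun p => ⟨prod.fst T A p.1, p.2⟩)
      (((continuous_hom (prod.fst T A)).comp continuous_subtype_val).subtype_mk _)
  refine ⟨O', hO, i, prod.lift (k ≫ s) (j ≫ prod.snd T A), fun o => ?_⟩
  exact congrArg (fun t => (prod.mk t (prod.snd T A o.1) : prod T A)) (hs (k o))

end ProductCover

/-! ### The mapping stack satisfies descent -/

section MappingStackDescent

universe t

open Pseudofunctor

variable {F : CatPresheaf.{u, v, w}} {ι : Type t} {T : Spc.{u}} {W : ι → Spc.{u}}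
  {q : ∀ i, W i ⟶ T}

theorem descentData_comm_iff {M N : fib F T} {i j : ι} (c : pull (q i) M ⟶ pull (q i) N)
    (d : pull (q j) M ⟶ pull (q j) N) {S : Spc.{u}} (r : S ⟶ T) (f : S ⟶ W i) (g : S ⟶ W j)
    (hf : f ≫ q i = r) (hg : g ≫ q j = r) :
    (F.map f.op.toLoc).toFunctor.map c ≫ ((F.toDescentData q).obj N).hom r f g hf hg =
        ((F.toDescentData q).obj M).hom r f g hf hg ≫ (F.map g.op.toLoc).toFunctor.map d ↔
      pullMor c f r r hf hf = pullMor d g r r hg hg := by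
  have e : ∀ z : fib F T, ((F.toDescentData q).obj z).hom r f g hf hg =
      (pullPull f (q i) r hf z).hom ≫ (pullPull g (q j) r hg z).inv := fun _ => rfl
  rw [e, e]
  have h1 : (F.map f.op.toLoc).toFunctor.map c ≫ (pullPull f (q i) r hf N).hom ≫
      (pullPull g (q j) r hg N).inv = (pullPull f (q i) r hf M).hom ≫ pullMor c f r r hf hf ≫
      (pullPull g (q j) r hg N).inv := by
    rw [map_eq_conj c f r r hf hf]; simp
  have h2 : ((pullPull f (q i) r hf M).hom ≫ (pullPull g (q j) r hg M).inv) ≫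
      (F.map g.op.toLoc).toFunctor.map d = (pullPull f (q i) r hf M).hom ≫
      pullMor d g r r hg hg ≫ (pullPull g (q j) r hg N).inv := by
    rw [map_eq_conj d g r r hg hg]; simp
  refine ((h1.congr_left).trans (h2.congr_right)).trans ?_
  rw [cancel_epi, cancel_mono]

variable {A : Spc.{u}}

theorem mappingStack_faithful (hF : IsTopStack F) (hq : IsCover q) :
    ((mappingStack A F).toDescentData q).Faithful := by
  have := hF.isStack
  refine ⟨fun {M N φ ψ} h => ?_⟩
  apply (F.fullyFaithfulToDescentData _ (hq.prod_map (A := A))).map_injective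
  ext i
  exact congrArg (fun m => DescentData.Hom.hom (F := mappingStack A F) (f := q) m i) h

/-- A map `S ⟶ T × A` need not be a product map. It is the graph `S ⟶ S × A` of its second component
followed by the product of its first component with `A`, so agreement along product maps gives
agreement along all maps. -/
theorem pullMor_eq_of_prod_map {M N : fib F (prod T A)} {i j : ι}
    (c : pull (prod.map (q i) (𝟙 A)) M ⟶ pull (prod.map (q i) (𝟙 A)) N)
    (d : pull (prod.map (q j) (𝟙 A)) M ⟶ pull (prod.map (q j) (𝟙 A)) N) {S : Spc.{u}}
    (r : S ⟶ prod T A) (f : S ⟶ prod (W i) A) (g : S ⟶ prod (W j) A)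
    (hf : f ≫ prod.map (q i) (𝟙 A) = r) (hg : g ≫ prod.map (q j) (𝟙 A) = r)
    (h : pullMor c (prod.map (f ≫ prod.fst _ _) (𝟙 A)) (prod.map (r ≫ prod.fst _ _) (𝟙 A))
        (prod.map (r ≫ prod.fst _ _) (𝟙 A)) (by subst hf; rfl) (by subst hf; rfl) =
      pullMor d (prod.map (g ≫ prod.fst _ _) (𝟙 A)) (prod.map (r ≫ prod.fst _ _) (𝟙 A))
        (prod.map (r ≫ prod.fst _ _) (𝟙 A)) (by subst hg; rfl) (by subst hg; rfl)) :
    pullMor c f r r hf hf = pullMor d g r r hg hg := by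
  have h1 := congrArg (fun m => pullMor m (prod.lift (𝟙 S) (r ≫ prod.snd _ _)) r r rfl rfl) h
  have h1 := (pullMor_pullMor _ _ _ _ _ _ _ _ _ _ _).symm.trans
    (h1.trans (pullMor_pullMor _ _ _ _ _ _ _ _ _ _ _))
  have hf₁ : prod.lift (𝟙 S) (r ≫ prod.snd _ _) ≫ prod.map (f ≫ prod.fst _ _) (𝟙 A) = f := by
    subst hf; rfl
  have hg₁ : prod.lift (𝟙 S) (r ≫ prod.snd _ _) ≫ prod.map (g ≫ prod.fst _ _) (𝟙 A) = g := by
    subst hg; rfl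
  simpa only [hf₁, hg₁] using h1

theorem mappingStack_full (hF : IsTopStack F) (hq : IsCover q) :
    ((mappingStack A F).toDescentData q).Full := by
  have := hF.isStack
  refine ⟨fun {M N} d => ?_⟩
  let c : ∀ i, pull (F := F) (prod.map (q i) (𝟙 A)) M ⟶ pull (F := F) (prod.map (q i) (𝟙 A)) N :=
    fun i => d.hom i
  let d' : (F.toDescentData (fun i => prod.map (q i) (𝟙 A))).obj M ⟶
      (F.toDescentData (fun i => prod.map (q i) (𝟙 A))).obj N :=
    { hom := c
      comm := by
        intro S r i j f g hf hg
        refine (descentData_comm_iff (q := fun i => prod.map (q i) (𝟙 A)) (c i) (c j)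
          r f g hf hg).2 ?_
        let f₀ := f ≫ prod.fst _ _
        let g₀ := g ≫ prod.fst _ _
        let r₀ := r ≫ prod.fst _ _
        have hf₀ : f₀ ≫ q i = r₀ := by subst hf; rfl
        have hg₀ : g₀ ≫ q j = r₀ := by subst hg; rfl
        have h0 := (descentData_comm_iff (F := mappingStack A F) (q := q) (d.hom i) (d.hom j)
          r₀ f₀ g₀ hf₀ hg₀).1 (d.comm r₀ f₀ g₀ hf₀ hg₀)
        have h0 := (pullMor_mappingStack (A := A) (F := F) _ _ _ _ _ _).symm.trans
          (h0.trans (pullMor_mappingStack (A := A) (F := F) _ _ _ _ _ _))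
        exact pullMor_eq_of_prod_map (c i) (c j) r f g hf hg h0 }
  refine ⟨(F.fullyFaithfulToDescentData _ (hq.prod_map (A := A))).preimage d', ?_⟩
  ext i
  exact congrArg (fun m => DescentData.Hom.hom (f := fun i => prod.map (q i) (𝟙 A)) m i)
    ((F.fullyFaithfulToDescentData _ (hq.prod_map (A := A))).map_preimage d')

/-- The objects of a descent datum for the mapping stack. -/
def mappingStackObj (D : (mappingStack A F).DescentData q) (i : ι) : fib F (prod (W i) A) :=
  D.obj i

/-- The gluing morphisms of a descent datum for the mapping stack. -/
def mappingStackHom (D : (mappingStack A F).DescentData q) {S : Spc.{u}} (r : S ⟶ T) {i j : ι}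
    (f : S ⟶ W i) (g : S ⟶ W j) (hf : f ≫ q i = r) (hg : g ≫ q j = r) :
    pull (prod.map f (𝟙 A)) (mappingStackObj D i) ⟶
      pull (prod.map g (𝟙 A)) (mappingStackObj D j) :=
  D.hom r f g hf hg

theorem pullMor_mappingStackHom (D : (mappingStack A F).DescentData q) {S S' : Spc.{u}} (r : S ⟶ T)
    {i j : ι} (f : S ⟶ W i) (g : S ⟶ W j) (hf : f ≫ q i = r) (hg : g ≫ q j = r) (k : S' ⟶ S)
    (f' : S' ⟶ W i) (g' : S' ⟶ W j) (r' : S' ⟶ T) (hf' : k ≫ f = f') (hg' : k ≫ g = g')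
    (hr' : k ≫ r = r') :
    pullMor (mappingStackHom D r f g hf hg) (prod.map k (𝟙 A)) (prod.map f' (𝟙 A))
      (prod.map g' (𝟙 A)) (by subst hf'; rfl) (by subst hg'; rfl) =
      mappingStackHom D r' f' g' (by rw [← hf', Category.assoc, hf, hr'])
        (by rw [← hg', Category.assoc, hg, hr']) :=
  (pullMor_mappingStack (A := A) (F := F) (D.hom r f g hf hg) k f' g' hf' hg').symm.trans
    (D.pullHom_hom k r r' hr' f g hf hg f' g' hf' hg')

theorem mappingStackHom_self (D : (mappingStack A F).DescentData q) {S : Spc.{u}} (r : S ⟶ T)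
    {i : ι} (f : S ⟶ W i) (hf : f ≫ q i = r) : mappingStackHom D r f f hf hf = 𝟙 _ :=
  D.hom_self r f hf

theorem mappingStackHom_comp (D : (mappingStack A F).DescentData q) {S : Spc.{u}} (r : S ⟶ T)
    {i j l : ι} (f : S ⟶ W i) (g : S ⟶ W j) (e : S ⟶ W l) (hf : f ≫ q i = r) (hg : g ≫ q j = r)
    (he : e ≫ q l = r) : mappingStackHom D r f g hf hg ≫ mappingStackHom D r g e hg he =
      mappingStackHom D r f e hf he :=
  D.hom_comp r f g e hf hg he

/-- A descent datum for the mapping stack is one for `F` along the product cover. -/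
def mappingStackDescentData (D : (mappingStack A F).DescentData q) :
    F.DescentData (fun i => prod.map (q i) (𝟙 A)) where
  obj i := mappingStackObj D i
  -- The gluing morphism of `D` for the first components, restricted along the graph of the second
  -- component.
  hom S r i j f g hf hg :=
    pullMor (mappingStackHom D (r ≫ prod.fst _ _) (f ≫ prod.fst _ _) (g ≫ prod.fst _ _)
        (by rw [← hf]; rfl) (by rw [← hg]; rfl))
      (prod.lift (𝟙 S) (r ≫ prod.snd _ _)) f g (by subst hf; rfl) (by subst hg; rfl)
  pullHom_hom := by
    intro S' S k r r' hr i j f g hf hg kf kg hkf hkg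
    subst hr hkf hkg
    -- Naturality of graphs in the source.
    have e : k ≫ prod.lift (𝟙 S) (r ≫ prod.snd _ _) =
        prod.lift (𝟙 S') ((k ≫ r) ≫ prod.snd T A) ≫ prod.map k (𝟙 A) := rfl
    have h := pullMor_mappingStackHom D (r ≫ prod.fst _ _) (f ≫ prod.fst _ _) (g ≫ prod.fst _ _)
      (by rw [← hf]; rfl) (by rw [← hg]; rfl) k ((k ≫ f) ≫ prod.fst _ _)
      ((k ≫ g) ≫ prod.fst _ _) ((k ≫ r) ≫ prod.fst _ _) rfl rfl rfl
    rw [← h]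
    refine (pullMor_pullMor _ _ _ _ _ _ _ _ _ _ _).trans (Eq.trans ?_
      (pullMor_pullMor _ _ _ _ _ _ _ _ _ _ _).symm)
    exact pullMor_congr _ e _ _ _ _
  hom_self := by
    intro S r i g hg
    rw [mappingStackHom_self]
    exact pullMor_id _ _ _
  hom_comp := by
    intro S r i j l f g e hf hg he
    rw [← mappingStackHom_comp D (r ≫ prod.fst _ _) (f ≫ prod.fst _ _) (g ≫ prod.fst _ _)
      (e ≫ prod.fst _ _) (by rw [← hf]; rfl) (by rw [← hg]; rfl) (by rw [← he]; rfl)]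
    exact (pullMor_comp _ _ _ _ _ _ _ _ _).symm

/-- For a product map the graph construction undoes itself: `S × A ⟶ (S × A) × A ⟶ S × A` is the
identity. -/
theorem mappingStackDescentData_hom (D : (mappingStack A F).DescentData q) {S : Spc.{u}}
    (r : S ⟶ T) {i j : ι} (f : S ⟶ W i) (g : S ⟶ W j) (hf : f ≫ q i = r) (hg : g ≫ q j = r) :
    (mappingStackDescentData D).hom (prod.map r (𝟙 A)) (prod.map f (𝟙 A)) (prod.map g (𝟙 A))
      (by subst hf; rfl) (by subst hg; rfl) = mappingStackHom D r f g hf hg := by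
  have h := congrArg (fun m => pullMor m (prod.lift (𝟙 _) (prod.snd S A))
    (prod.map f (𝟙 A)) (prod.map g (𝟙 A)) rfl rfl) (pullMor_mappingStackHom D r f g hf hg
      (prod.fst S A) _ _ _ rfl rfl rfl)
  refine h.symm.trans ((pullMor_pullMor _ _ _ _ _ _ _ _ _ _ _).trans ?_)
  exact pullMor_self _ _ rfl _ _

/-- Effective descent for `F` along the cover multiplied by `A` yields the object; the comparison
isomorphisms are then only needed along product maps. -/
theorem mappingStack_essSurj (hF : IsTopStack F) (hq : IsCover q) :
    ((mappingStack A F).toDescentData q).EssSurj := by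
  have := hF.isStack
  have := F.isEquivalence_toDescentData _ (hq.prod_map (A := A))
  refine ⟨fun D => ?_⟩
  let M := (F.toDescentData (fun i => prod.map (q i) (𝟙 A))).objPreimage
    (mappingStackDescentData D)
  let E : (F.toDescentData (fun i => prod.map (q i) (𝟙 A))).obj M ≅ mappingStackDescentData D :=
    (F.toDescentData (fun i => prod.map (q i) (𝟙 A))).objObjPreimageIso _
  let θ : ∀ i, ((mappingStack A F).toDescentData q |>.obj M).obj i ≅ D.obj i := fun i =>
    { hom := E.hom.hom i
      inv := E.inv.hom i
      hom_inv_id := congrArg (fun t => Pseudofunctor.DescentData.Hom.hom t i) E.hom_inv_id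
      inv_hom_id := congrArg (fun t => Pseudofunctor.DescentData.Hom.hom t i) E.inv_hom_id }
  refine ⟨M, ⟨DescentData.isoMk θ ?_⟩⟩
  intro S r i j f g hf hg
  have h := E.hom.comm (prod.map r (𝟙 A)) (prod.map f (𝟙 A)) (prod.map g (𝟙 A))
    (by subst hf; rfl) (by subst hg; rfl)
  rw [mappingStackDescentData_hom D r f g hf hg] at h
  have e : ((mappingStack A F).toDescentData q |>.obj M).hom r f g hf hg =
      ((F.toDescentData (fun i => prod.map (q i) (𝟙 A))).obj M).hom (prod.map r (𝟙 A))
        (prod.map f (𝟙 A)) (prod.map g (𝟙 A)) (by subst hf; rfl) (by subst hg; rfl) := by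
    change ((mappingStack A F).mapComp' (q i).op.toLoc f.op.toLoc r.op.toLoc _).inv.toNatTrans.app _
      ≫ ((mappingStack A F).mapComp' (q j).op.toLoc g.op.toLoc r.op.toLoc _).hom.toNatTrans.app _ = _
    rw [mappingStack_mapComp' _ _ _ hf, mappingStack_mapComp' _ _ _ hg]
    rfl
  rw [e]
  exact h

theorem IsTopStack.mappingStack (hF : IsTopStack F) (A : Spc.{u}) :
    IsTopStack (mappingStack A F) where
  isStack := by
    refine IsStack.of_isStackFor fun T R hR => ?_
    rw [isStackFor_iff]
    -- A covering sieve is generated by the family of all its own arrows.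
    have hq : IsCover (fun f : R.arrows.category => f.obj.hom) := by
      unfold IsCover
      rwa [Sieve.ofArrows_category', Sieve.generate_sieve]
    have := mappingStack_faithful (A := A) hF hq
    have := mappingStack_full (A := A) hF hq
    have := mappingStack_essSurj (A := A) hF hq
    exact { }
  isGroupoid T := hF.isGroupoid (prod T A)

end MappingStackDescent

/-! ### Fibre products over a stack -/

section FiberProducts

variable {F : CatPresheaf.{u, v, w}}

/-- Every 2-morphism of a stack in groupoids is a 2-isomorphism. -/
noncomputable def IsTopStack.iso (hF : IsTopStack F) {T : Spc.{u}} {M N : fib F T} (φ : M ⟶ N) :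
    M ≅ N :=
  have := hF.isGroupoid T
  asIso φ

@[simp]
theorem IsTopStack.iso_hom (hF : IsTopStack F) {T : Spc.{u}} {M N : fib F T} (φ : M ⟶ N) :
    (hF.iso φ).hom = φ := rfl

theorem IsFiberProduct.exists_lift {X Y Z : Spc.{u}} {x : fib F X} {y : fib F Y} {a : Z ⟶ X}
    {b : Z ⟶ Y} {φ : pull a x ≅ pull b y} (h : IsFiberProduct x y a b φ) {S : Spc.{u}}
    (a' : S ⟶ X) (b' : S ⟶ Y) (φ' : pull a' x ≅ pull b' y) :
    ∃ (l : S ⟶ Z) (ha : l ≫ a = a') (hb : l ≫ b = b'), pullMor φ.hom l a' b' ha hb = φ'.hom :=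
  (h S a' b' φ').exists

theorem IsFiberProduct.hom_ext {X Y Z : Spc.{u}} {x : fib F X} {y : fib F Y} {a : Z ⟶ X}
    {b : Z ⟶ Y} {φ : pull a x ≅ pull b y} (h : IsFiberProduct x y a b φ) {S : Spc.{u}}
    {l l' : S ⟶ Z} (a' : S ⟶ X) (b' : S ⟶ Y) (ha : l ≫ a = a') (hb : l ≫ b = b')
    (ha' : l' ≫ a = a') (hb' : l' ≫ b = b')
    (e : pullMor φ.hom l a' b' ha hb = pullMor φ.hom l' a' b' ha' hb') : l = l' :=
  (h S a' b' (pullIso φ l' a' b' ha' hb')).unique ⟨ha, hb, e⟩ ⟨ha', hb', rfl⟩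

/-- A local lift of `y` to the chart, together with its 2-isomorphism, is precisely a local section
of `b`. -/
theorem IsFiberProduct.isCover {X Y Z : Spc.{u}} {x : fib F X} {y : fib F Y} {a : Z ⟶ X}
    {b : Z ⟶ Y} {φ : pull a x ≅ pull b y} (h : IsFiberProduct x y a b φ) (hx : IsEpimorphism x) :
    IsCover (fun _ : Unit => b) := by
  intro t
  obtain ⟨U, i, hi, ht, c, ⟨e⟩⟩ := hx Y y t
  obtain ⟨l, -, hb, -⟩ := h.exists_lift c i e
  refine ⟨U, i, hi, ht, ?_⟩
  rw [Sieve.mem_ofArrows_iff]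
  exact ⟨(), l, hb.symm⟩

end FiberProducts

/-! ### Local lifts and points -/

section LocalLifts

/-- The inclusion of an open subspace. -/
def openIncl {T : Spc.{u}} (O : Opens T) : CompactlyGenerated.of.{u, u} O ⟶ T :=
  mkHom (fun p => p.1) continuous_subtype_val

theorem isCover_openIncl {ι : Type*} {T : Spc.{u}} (O : ι → Opens T) (h : ∀ t : T, ∃ i, t ∈ O i) :
    IsCover (fun i => openIncl (O i)) :=
  isCover_opens O h

/-- The restriction of a continuous map to the preimage of an open subspace. -/
def openRestrict {S T : Spc.{u}} (f : S ⟶ T) (O : Opens T) (O' : Opens S)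
    (h : ∀ s ∈ O', f s ∈ O) :
    CompactlyGenerated.of.{u, u} O' ⟶ CompactlyGenerated.of.{u, u} O :=
  mkHom (fun p => ⟨f p.1, h p.1 p.2⟩)
    (((continuous_hom f).comp continuous_subtype_val).subtype_mk _)

theorem IsCover.exists_local_lift {P T S : Spc.{u}} {b : P ⟶ T} (hb : IsCover (fun _ : Unit => b))
    (b' : S ⟶ T) (s : S) : ∃ (O : Opens S) (_ : s ∈ O)
      (σ : CompactlyGenerated.of.{u, u} O ⟶ P), σ ≫ b = openIncl O ≫ b' := by
  obtain ⟨O, hO, -, σ, hσ⟩ := hb.exists_local_section (b' s)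
  refine ⟨⟨b' ⁻¹' O, O.isOpen.preimage (continuous_hom b')⟩, hO,
    openRestrict b' O _ (fun _ h => h) ≫ σ, ?_⟩
  ext o
  exact hσ _

/-- The one-point space. -/
def point : Spc.{u} := CompactlyGenerated.of.{u, u} PUnit.{u + 1}

/-- The inclusion of a point. -/
def pointMap {T : Spc.{u}} (t : T) : point.{u} ⟶ T :=
  mkHom (X := point.{u}) (fun _ => t) continuous_const

end LocalLifts

/-! ### Values of 2-morphisms at points -/

section Stalks

variable {F : CatPresheaf.{u, v, w}} {T : Spc.{u}} {y z : fib F T}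

/-- The value at a point of a 2-morphism over `T`. -/
def stalk {S : Spc.{u}} {b : S ⟶ T} (ψ : pull b y ⟶ pull b z) (s : S) :
    Σ t : T, (pull (pointMap t) y ⟶ pull (pointMap t) z) :=
  ⟨b s, pullMor ψ (pointMap s) (pointMap (b s)) (pointMap (b s)) rfl rfl⟩

theorem stalk_pullMor {S S' : Spc.{u}} {b : S ⟶ T} (ψ : pull b y ⟶ pull b z) (h : S' ⟶ S)
    (b' : S' ⟶ T) (hb : h ≫ b = b') (s : S') : stalk (pullMor ψ h b' b' hb hb) s = stalk ψ (h s) := by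
  subst hb
  exact congrArg (Sigma.mk (b (h s))) (pullMor_pullMor _ _ _ _ _ _ _ _ _ _ _)

theorem stalk_eq_iff {S S' : Spc.{u}} {b : S ⟶ T} (ψ : pull b y ⟶ pull b z) {b' : S' ⟶ T}
    (ψ' : pull b' y ⟶ pull b' z) (s : S) (s' : S') :
    stalk ψ s = stalk ψ' s' ↔ ∃ e : b s = b' s',
      pullMor ψ (pointMap s) (pointMap (b s)) (pointMap (b s)) rfl rfl =
        pullMor ψ' (pointMap s') (pointMap (b s)) (pointMap (b s)) (by rw [e]; rfl)
          (by rw [e]; rfl) := by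
  -- The base points are made variables so that an equality between them can be substituted, which
  -- removes the heterogeneous equality.
  have key : ∀ (t t' : T) (h : pointMap s ≫ b = pointMap t) (h' : pointMap s' ≫ b' = pointMap t'),
      (⟨t, pullMor ψ (pointMap s) (pointMap t) (pointMap t) h h⟩ :
        Σ t : T, (pull (pointMap t) y ⟶ pull (pointMap t) z)) =
        ⟨t', pullMor ψ' (pointMap s') (pointMap t') (pointMap t') h' h'⟩ ↔
      ∃ e : t = t', pullMor ψ (pointMap s) (pointMap t) (pointMap t) h h =
        pullMor ψ' (pointMap s') (pointMap t) (pointMap t) (by rw [e, h']) (by rw [e, h']) := by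
    intro t t' h h'
    constructor
    · intro e
      obtain rfl : t = t' := congrArg Sigma.fst e
      exact ⟨rfl, eq_of_heq (Sigma.mk.inj e).2⟩
    · rintro ⟨rfl, e⟩
      rw [e]
  exact key _ _ rfl rfl

end Stalks

/-! ### Sheaves of isomorphisms that are representable after a cover -/

section LocallyRepresentable

variable {F : CatPresheaf.{u, v, w}} {T P Q : Spc.{u}} {y z : fib F T} {b : P ⟶ T} {p : Q ⟶ P}

/-- The sheaf of 2-morphisms from `y` to `z` becomes, after pullback along `b`, the space `Q`. -/
def RepresentsHomAlong (y z : fib F T) (b : P ⟶ T) (p : Q ⟶ P)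
    (κ : pull (p ≫ b) y ⟶ pull (p ≫ b) z) : Prop :=
  ∀ (S : Spc.{u}) (s : S ⟶ P) (ψ : pull (s ≫ b) y ⟶ pull (s ≫ b) z), ∃! k : S ⟶ Q,
    ∃ hk : k ≫ p = s, pullMor κ k (s ≫ b) (s ≫ b) (by rw [← hk, Category.assoc])
      (by rw [← hk, Category.assoc]) = ψ

variable {κ : pull (p ≫ b) y ⟶ pull (p ≫ b) z}

/-- Uniqueness of the classifying map from the one-point space. -/
theorem RepresentsHomAlong.eq_of_stalk (hQ : RepresentsHomAlong y z b p κ) {w₁ w₂ : Q}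
    (hp : p w₁ = p w₂) (hs : stalk κ w₁ = stalk κ w₂) : w₁ = w₂ := by
  obtain ⟨e, h⟩ := (stalk_eq_iff _ _ _ _).1 hs
  have := (hQ point (pointMap (p w₁))
    (pullMor κ (pointMap w₁) (pointMap (p w₁) ≫ b) (pointMap (p w₁) ≫ b) rfl rfl)).unique
    (y₁ := pointMap w₁) (y₂ := pointMap w₂) ⟨rfl, rfl⟩ ⟨by rw [hp]; rfl, h.symm⟩
  exact congrArg (fun m => m PUnit.unit) this

/-- 2-morphisms are determined by their values at points. -/
theorem RepresentsHomAlong.hom_ext (hQ : RepresentsHomAlong y z b p κ) (hF : IsTopStack F)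
    (hb : IsCover (fun _ : Unit => b)) {S : Spc.{u}} {b' : S ⟶ T} (ψ ψ' : pull b' y ⟶ pull b' z)
    (h : ∀ s, stalk ψ s = stalk ψ' s) : ψ = ψ' := by
  -- After a local lift to `P` both 2-morphisms are classified by maps to the space `Q`, and maps of
  -- spaces are determined by their points.
  choose O hO σ hσ using fun s => hb.exists_local_lift b' s
  refine pull_hom_ext hF (isCover_openIncl O (fun s => ⟨s, hO s⟩)) ψ ψ' (fun s => ?_)
  obtain ⟨k, ⟨hk, e⟩, -⟩ := hQ _ (σ s) (pullMor ψ (openIncl (O s)) _ _ (hσ s).symm (hσ s).symm)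
  obtain ⟨k', ⟨hk', e'⟩, -⟩ :=
    hQ _ (σ s) (pullMor ψ' (openIncl (O s)) _ _ (hσ s).symm (hσ s).symm)
  have hkk : k = k' := by
    ext o
    refine hQ.eq_of_stalk ?_ ?_
    · exact congrArg (fun m => m o) (hk.trans hk'.symm)
    · rw [← stalk_pullMor κ k (σ s ≫ b) (by rw [← hk, Category.assoc]) o,
        ← stalk_pullMor κ k' (σ s ≫ b) (by rw [← hk', Category.assoc]) o, e, e',
        stalk_pullMor, stalk_pullMor, h]
  subst hkk
  exact pullMor_eq_change (e.symm.trans e') (hσ s) (hσ s)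

/-- The space of values of the sheaf of 2-morphisms at points. -/
def stalkQuotient (κ : pull (p ≫ b) y ⟶ pull (p ≫ b) z) : Spc.{u} :=
  CompactlyGenerated.of.{u, u} (Quotient (Setoid.ker (stalk κ)))

/-- The quotient map. -/
def stalkQuotient.proj (κ : pull (p ≫ b) y ⟶ pull (p ≫ b) z) : Q ⟶ stalkQuotient κ :=
  mkHom (Y := stalkQuotient κ) (Quotient.mk (Setoid.ker (stalk κ))) continuous_quotient_mk'

theorem stalkQuotient.proj_eq_iff {w₁ w₂ : Q} :
    stalkQuotient.proj κ w₁ = stalkQuotient.proj κ w₂ ↔ stalk κ w₁ = stalk κ w₂ :=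
  Quotient.eq (r := Setoid.ker (stalk κ))

theorem stalkQuotient.proj_surjective (ζ : stalkQuotient κ) : ∃ w, stalkQuotient.proj κ w = ζ :=
  Quotient.exists_rep ζ

theorem stalkQuotient.isQuotientMap : Topology.IsQuotientMap (stalkQuotient.proj κ) :=
  isQuotientMap_quotient_mk'

/-- The structure map to the base. -/
def stalkQuotient.base (κ : pull (p ≫ b) y ⟶ pull (p ≫ b) z) : stalkQuotient κ ⟶ T :=
  mkHom (X := stalkQuotient κ) (Quotient.lift (p ≫ b) (fun _ _ h => congrArg Sigma.fst h))
    ((continuous_hom (p ≫ b)).quotient_lift _)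

/-- A quotient map need not have local sections; this one does. Over an open `O` in `T` with a
section `σ` of `b`, each point of `Q` can be moved to the point with the same value whose image in
`P` lies on `σ`. The resulting map `k` is continuous and constant on classes, so it descends to a
local section of the quotient map. -/
theorem RepresentsHomAlong.isCover_proj (hQ : RepresentsHomAlong y z b p κ)
    (hb : IsCover (fun _ : Unit => b)) : IsCover (fun _ : Unit => stalkQuotient.proj κ) := by
  refine isCover_of_local_sections fun ζ => ?_
  obtain ⟨O, hO, -, σ, hσ⟩ := hb.exists_local_section (stalkQuotient.base κ ζ)
  let OZ : Opens (stalkQuotient κ) :=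
    ⟨stalkQuotient.base κ ⁻¹' O, O.isOpen.preimage (continuous_hom _)⟩
  let OQ : Opens Q := ⟨stalkQuotient.proj κ ⁻¹' OZ, OZ.isOpen.preimage (continuous_hom _)⟩
  let s := openRestrict (p ≫ b) O OQ (fun _ h => h) ≫ σ
  have hs : openIncl OQ ≫ p ≫ b = s ≫ b := by
    ext o
    exact (hσ (openRestrict (p ≫ b) O OQ (fun _ h => h) o)).symm
  obtain ⟨k, ⟨hk, e⟩, -⟩ := hQ _ s (pullMor κ (openIncl OQ) _ _ hs hs)
  have hstalk : ∀ o, stalk κ (k o) = stalk κ (openIncl OQ o) := by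
    intro o
    rw [← stalk_pullMor κ k (s ≫ b) (by rw [← hk, Category.assoc]) o, e, stalk_pullMor]
  have hkp : ∀ o, p (k o) = s o := fun o => congrArg (fun m => m o) hk
  have hconst : ∀ o o' : OQ, stalk κ o.1 = stalk κ o'.1 → k o = k o' := by
    intro o o' h
    refine hQ.eq_of_stalk ?_ ?_
    · rw [hkp, hkp]
      exact congrArg σ (Subtype.ext (congrArg Sigma.fst h))
    · rw [hstalk, hstalk]
      exact h
  have hsurj : ∀ o : OZ, ∃ o' : OQ, stalkQuotient.proj κ o'.1 = o.1 := by
    rintro ⟨o, ho⟩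
    obtain ⟨w, rfl⟩ := stalkQuotient.proj_surjective o
    exact ⟨⟨w, ho⟩, rfl⟩
  choose r hr using hsurj
  have hkr : ∀ o' : OQ, k (r ⟨stalkQuotient.proj κ o'.1, o'.2⟩) = k o' := fun o' =>
    hconst _ _ (stalkQuotient.proj_eq_iff.1 (hr ⟨stalkQuotient.proj κ o'.1, o'.2⟩))
  -- The restriction of a quotient map over an open subset is again a quotient map, so continuity of
  -- the section follows from that of `k`.
  have hquot : Topology.IsQuotientMap
      ((OZ : Set (stalkQuotient κ)).restrictPreimage (stalkQuotient.proj κ)) :=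
    stalkQuotient.isQuotientMap.restrictPreimage_isOpen OZ.isOpen
  have hcont : Continuous (fun o : OZ => k (r o)) := by
    rw [hquot.continuous_iff]
    have : ((fun o : OZ => k (r o)) ∘
        (OZ : Set (stalkQuotient κ)).restrictPreimage (stalkQuotient.proj κ)) = k :=
      funext hkr
    rw [this]
    exact continuous_hom k
  refine ⟨OZ, hO, (), mkHom (fun o : OZ => k (r o)) hcont, fun o => ?_⟩
  refine Eq.trans ?_ (hr o)
  exact stalkQuotient.proj_eq_iff.2 (hstalk (r o))

/-- A sheaf of 2-morphisms that is a space after pullback along a map with local sections is a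
space. -/
theorem RepresentsHomAlong.exists_space (hQ : RepresentsHomAlong y z b p κ) (hF : IsTopStack F)
    (hb : IsCover (fun _ : Unit => b)) :
    ∃ (Z : Spc.{u}) (c : Z ⟶ T) (ψ : pull c y ≅ pull c z),
      ∀ (S : Spc.{u}) (b' : S ⟶ T) (ψ' : pull b' y ≅ pull b' z),
        ∃! h : S ⟶ Z, ∃ hc : h ≫ c = b', pullMor ψ.hom h b' b' hc hc = ψ'.hom := by
  -- The universal 2-morphism `κ` descends to the quotient: its two pullbacks to an overlap have
  -- equal values at all points, by the definition of the equivalence relation.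
  obtain ⟨ψ, hψ⟩ := exists_glue_iso hF (hQ.isCover_proj hb) (x := y) (y := z)
    (a := stalkQuotient.base κ) (b := stalkQuotient.base κ) (fun _ => p ≫ b) (fun _ => p ≫ b)
    (fun _ => rfl) (fun _ => rfl) (fun _ => κ) (by
      intro _ _ S f g r hf hg
      refine hQ.hom_ext hF hb _ _ fun s => ?_
      have h1 : f ≫ p ≫ b = r ≫ stalkQuotient.base κ := by rw [← hf]; rfl
      have h2 : g ≫ p ≫ b = r ≫ stalkQuotient.base κ := by rw [← hg]; rfl
      rw [stalk_pullMor κ f _ h1 s, stalk_pullMor κ g _ h2 s]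
      exact stalkQuotient.proj_eq_iff.1 (congrArg (fun m => m s) (hf.trans hg.symm)))
  have hψ : pullMor ψ.hom (stalkQuotient.proj κ) (p ≫ b) (p ≫ b) rfl rfl = κ := hψ ()
  have hst : ∀ w, stalk ψ.hom (stalkQuotient.proj κ w) = stalk κ w := by
    intro w
    rw [← stalk_pullMor ψ.hom (stalkQuotient.proj κ) (p ≫ b) rfl, hψ]
  have hinj : ∀ ζ ζ' : stalkQuotient κ, stalk ψ.hom ζ = stalk ψ.hom ζ' → ζ = ζ' := by
    intro ζ ζ' h
    obtain ⟨w, rfl⟩ := stalkQuotient.proj_surjective ζ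
    obtain ⟨w', rfl⟩ := stalkQuotient.proj_surjective ζ'
    rw [hst, hst] at h
    exact stalkQuotient.proj_eq_iff.2 h
  refine ⟨stalkQuotient κ, stalkQuotient.base κ, ψ, fun S b' ψ' => ?_⟩
  have hloc : ∀ s : S, ∃ (O : Opens S) (_ : s ∈ O)
      (k : CompactlyGenerated.of.{u, u} O ⟶ stalkQuotient κ),
      ∀ o : O, stalk ψ.hom (k o) = stalk ψ'.hom o.1 := by
    intro s
    obtain ⟨O, hO, σ, hσ⟩ := hb.exists_local_lift b' s
    obtain ⟨k, ⟨hk, e⟩, -⟩ := hQ _ σ (pullMor ψ'.hom (openIncl O) _ _ hσ.symm hσ.symm)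
    refine ⟨O, hO, k ≫ stalkQuotient.proj κ, fun o => ?_⟩
    refine (hst (k o)).trans ?_
    rw [← stalk_pullMor κ k (σ ≫ b) (by rw [← hk, Category.assoc]) o, e, stalk_pullMor]
    rfl
  choose O hO k hk using hloc
  -- By `hinj` a point of the quotient is determined by its value. Hence the local classifying maps
  -- agree on overlaps, and this pointwise choice is continuous.
  let h : S → stalkQuotient κ := fun s => k s ⟨s, hO s⟩
  have hh : ∀ s, stalk ψ.hom (h s) = stalk ψ'.hom s := fun s => hk s ⟨s, hO s⟩
  have hcont : Continuous h := by
    rw [continuous_iff_continuousAt]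
    intro s
    have h1 : ∀ o : O s, h o.1 = k s o := fun o => hinj _ _ ((hh o.1).trans (hk s o).symm)
    have h2 : Continuous (fun o : O s => h o.1) := by
      have : (fun o : O s => h o.1) = k s := funext h1
      rw [this]
      exact continuous_hom (k s)
    exact (((O s).isOpen.isOpenEmbedding_subtypeVal.continuousAt_iff (x := ⟨s, hO s⟩)).1
      h2.continuousAt)
  refine ⟨mkHom h hcont, ?_, ?_⟩
  · have hc : mkHom h hcont ≫ stalkQuotient.base κ = b' := by
      ext s
      exact congrArg Sigma.fst (hh s)
    refine ⟨hc, hQ.hom_ext hF hb _ _ fun s => ?_⟩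
    rw [stalk_pullMor]
    exact hh s
  · rintro h' ⟨hc, e⟩
    ext s
    refine hinj _ _ ?_
    refine Eq.trans ?_ (hh s).symm
    rw [← e, stalk_pullMor]

end LocallyRepresentable

/-- The diagonal of a pretopological stack is representable. -/
theorem IsPretopological.hasRepresentableDiagonal {F : CatPresheaf.{u, v, w}}
    (hF : IsPretopological F) : HasRepresentableDiagonal F := by
  obtain ⟨X, x, hx, hepi⟩ := hF.exists_chart
  intro T y z
  obtain ⟨P, a₁, b₁, μ, hP⟩ := hx T y
  obtain ⟨P', a₂, b₂, ν, hP'⟩ := hx T z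
  let f := prod.lift a₁ b₁
  let g := prod.lift a₂ b₂
  -- Over `P` the object `y` is identified with the chart by `μ`. An isomorphism from `y` to `z`
  -- over `P` is then one from the chart to `z`, that is, a lift to `P'` with the same components in
  -- `X` and `T`. So the representing space over `P` is the fibre product of `P` and `P'` over `X ×
  -- T`.
  let p := pb.fst f g
  let p' := pb.snd f g
  have h1 : p' ≫ a₂ = p ≫ a₁ := by
    ext s
    exact (congrArg (prod.fst X T) (pb.condition f g s)).symm
  have h2 : p' ≫ b₂ = p ≫ b₁ := by
    ext s
    exact (congrArg (prod.snd X T) (pb.condition f g s)).symm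
  let κ : pull (p ≫ b₁) y ⟶ pull (p ≫ b₁) z :=
    pullMor μ.inv p (p ≫ b₁) (p ≫ a₁) rfl rfl ≫ pullMor ν.hom p' (p ≫ a₁) (p ≫ b₁) h1 h2
  refine RepresentsHomAlong.exists_space (b := b₁) (p := p) (κ := κ) ?_ hF.isTopStack
    (hP.isCover hepi)
  intro S s ψ
  have hκ : ∀ (k : S ⟶ pb f g) (e : k ≫ p = s),
      pullMor κ k (s ≫ b₁) (s ≫ b₁) (by rw [← e, Category.assoc]) (by rw [← e, Category.assoc]) =
      pullMor μ.inv s (s ≫ b₁) (s ≫ a₁) rfl rfl ≫ pullMor ν.hom (k ≫ p') (s ≫ a₁) (s ≫ b₁)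
        (by rw [Category.assoc, h1, ← Category.assoc, e])
        (by rw [Category.assoc, h2, ← Category.assoc, e]) := by
    intro k e
    subst e
    rw [pullMor_comp _ _ k _ ((k ≫ p) ≫ a₁) _ (Category.assoc _ _ _).symm
      (Category.assoc _ _ _).symm, pullMor_pullMor, pullMor_pullMor]
  have hinv : pullMor μ.inv s (s ≫ b₁) (s ≫ a₁) rfl rfl ≫
      pullMor μ.hom s (s ≫ a₁) (s ≫ b₁) rfl rfl = 𝟙 _ :=
    (pullIso μ s (s ≫ a₁) (s ≫ b₁) rfl rfl).inv_hom_id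
  have hinv' : pullMor μ.hom s (s ≫ a₁) (s ≫ b₁) rfl rfl ≫
      pullMor μ.inv s (s ≫ b₁) (s ≫ a₁) rfl rfl = 𝟙 _ :=
    (pullIso μ s (s ≫ a₁) (s ≫ b₁) rfl rfl).hom_inv_id
  obtain ⟨l, la, lb, hl⟩ := hP'.exists_lift (s ≫ a₁) (s ≫ b₁)
    (hF.isTopStack.iso (pullMor μ.hom s (s ≫ a₁) (s ≫ b₁) rfl rfl ≫ ψ))
  have hcond : ∀ t, f (s t) = g (l t) := by
    intro t
    have e1 : a₂ (l t) = a₁ (s t) := congrArg (fun m => m t) la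
    have e2 : b₂ (l t) = b₁ (s t) := congrArg (fun m => m t) lb
    exact (congrArg₂ (fun c d => (prod.mk c d : prod X T)) e1 e2).symm
  refine ⟨pb.lift s l hcond, ⟨rfl, ?_⟩, ?_⟩
  · refine (hκ _ rfl).trans ?_
    refine (congrArg (pullMor μ.inv s (s ≫ b₁) (s ≫ a₁) rfl rfl ≫ ·) hl).trans ?_
    rw [IsTopStack.iso_hom, reassoc_of% hinv]
  · rintro k ⟨hk, e⟩
    have e3 : k ≫ p' = l := by
      refine hP'.hom_ext (s ≫ a₁) (s ≫ b₁) (by rw [Category.assoc, h1, ← Category.assoc, hk])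
        (by rw [Category.assoc, h2, ← Category.assoc, hk]) la lb ?_
      rw [hl, IsTopStack.iso_hom, ← e, hκ k hk, reassoc_of% hinv']
    ext t
    have e4 : p (k t) = s t := congrArg (fun m => m t) hk
    have e5 : p' (k t) = l t := congrArg (fun m => m t) e3
    exact Subtype.ext (Prod.ext e4 e5)

/-- Over a stack with representable diagonal, all morphisms from spaces are representable. -/
theorem HasRepresentableDiagonal.isRepresentable {F : CatPresheaf.{u, v, w}}
    (hF : HasRepresentableDiagonal F) {X : Spc.{u}} (x : fib F X) : IsRepresentable x := by
  intro T y
  -- The fibre product of `X` and `T` over `F` is the space of isomorphisms between the two objects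
  -- pulled back to `X × T`.
  obtain ⟨Z, c, ψ, hZ⟩ := hF (prod X T) (pull (prod.fst X T) x) (pull (prod.snd X T) y)
  let φ : pull (c ≫ prod.fst X T) x ≅ pull (c ≫ prod.snd X T) y :=
    (pullPull c (prod.fst X T) _ rfl x).symm ≪≫ ψ ≪≫ pullPull c (prod.snd X T) _ rfl y
  refine ⟨Z, c ≫ prod.fst X T, c ≫ prod.snd X T, φ, fun S a' b' φ' => ?_⟩
  let r : S ⟶ prod X T := prod.lift a' b'
  let ψ' : pull r (pull (prod.fst X T) x) ≅ pull r (pull (prod.snd X T) y) :=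
    pullPull r (prod.fst X T) a' rfl x ≪≫ φ' ≪≫ (pullPull r (prod.snd X T) b' rfl y).symm
  have key : ∀ (h : S ⟶ Z) (hc : h ≫ c = r), pullMor φ.hom h a' b'
      (by rw [← Category.assoc, hc]; rfl) (by rw [← Category.assoc, hc]; rfl) =
      (pullPull r (prod.fst X T) a' rfl x).inv ≫ pullMor ψ.hom h r r hc hc ≫
        (pullPull r (prod.snd X T) b' rfl y).hom := by
    intro h hc
    have e1 : h ≫ c ≫ prod.fst X T = a' := by rw [← Category.assoc, hc]; rfl
    have e2 : h ≫ c ≫ prod.snd X T = b' := by rw [← Category.assoc, hc]; rfl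
    change pullMor ((pullPull c (prod.fst X T) _ rfl x).inv ≫ ψ.hom ≫
      (pullPull c (prod.snd X T) _ rfl y).hom) h a' b' e1 e2 = _
    rw [pullMor_comp _ _ h a' r b' e1 hc e2, pullMor_comp _ _ h r r b' hc hc e2,
      pullMor_pullPull, pullMor_pullPull_inv]
  obtain ⟨h, ⟨hc, e⟩, hu⟩ := hZ S r ψ'
  refine ⟨h, ⟨by rw [← Category.assoc, hc]; rfl, by rw [← Category.assoc, hc]; rfl, ?_⟩, ?_⟩
  · rw [key h hc, e]
    simp [ψ']
  · rintro h' ⟨ha, hb, e'⟩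
    have hc' : h' ≫ c = r := by
      ext s
      have e1 : prod.fst X T (c (h' s)) = a' s := congrArg (fun m => m s) ha
      have e2 : prod.snd X T (c (h' s)) = b' s := congrArg (fun m => m s) hb
      exact Prod.ext e1 e2
    refine hu h' ⟨hc', ?_⟩
    rw [key h' hc'] at e'
    simp [ψ', ← e']

/-! ### The diagonal of the mapping stack -/

section MappingDiagonal

variable {A Z₀ T : Spc.{u}}

/-- The families of sections of `b : Z₀ ⟶ T × A` over the slices `{t} × A`. -/
def SectionSpace (b : Z₀ ⟶ prod T A) : Type u :=
  {p : C(A, Z₀) × T // ∀ a, b (p.1 a) = prod.mk p.2 a}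

instance (b : Z₀ ⟶ prod T A) : TopologicalSpace (SectionSpace b) :=
  inferInstanceAs (TopologicalSpace {p : C(A, Z₀) × T // ∀ a, b (p.1 a) = prod.mk p.2 a})

/-- The projection to the base. -/
def SectionSpace.base (b : Z₀ ⟶ prod T A) : kify (SectionSpace b) ⟶ T :=
  mkHom (fun p => (kify.val p).1.2)
    (continuous_snd.comp (continuous_subtype_val.comp kify.continuous_val))

/-- Evaluation of sections. -/
def SectionSpace.ev (b : Z₀ ⟶ prod T A) : prod (kify (SectionSpace b)) A ⟶ Z₀ :=
  mkHom _ (continuous_evaluation (H := SectionSpace b) (fun p => p.1.1)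
    (continuous_fst.comp continuous_subtype_val))

theorem SectionSpace.ev_comp (b : Z₀ ⟶ prod T A) :
    SectionSpace.ev b ≫ b = prod.map (SectionSpace.base b) (𝟙 A) := by
  ext p
  exact (kify.val (kify.val p).1).2 (kify.val p).2

/-- The transpose of a family of sections. -/
def SectionSpace.lift [LocallyCompactSpace A] [T2Space A] {S : Spc.{u}} (b : Z₀ ⟶ prod T A)
    (b' : S ⟶ T) (h : prod S A ⟶ Z₀) (hb : h ≫ b = prod.map b' (𝟙 A)) :
    S ⟶ kify (SectionSpace b) :=
  mkHom (fun s => kify.mk ⟨(⟨fun a => h (prod.mk s a), (continuous_hom h).comp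
      ((prod.continuous_mk S A).comp (by fun_prop : Continuous fun a : A => (s, a)))⟩, b' s),
      fun a => congrArg (fun m => m (prod.mk s a)) hb⟩)
    (kify.continuous_mk_comp (X := SectionSpace b) _
      (Continuous.subtype_mk ((continuous_curry h _ (fun _ _ => rfl)).prodMk
        (continuous_hom b')) _))

/-- An isomorphism over `S × A` lying over `b' : S ⟶ T` is a map `S × A ⟶ Z₀` over `T × A`. By the
exponential law this is a map from `S` to the space of sections of `b` over the slices `{t} × A`,
with base component `b'`. -/
theorem HasRepresentableDiagonal.mappingStack [LocallyCompactSpace A] [T2Space A]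
    {F : CatPresheaf.{u, v, w}} (hF : HasRepresentableDiagonal F) :
    HasRepresentableDiagonal (mappingStack A F) := by
  intro T (y : fib F (prod T A)) (z : fib F (prod T A))
  obtain ⟨Z₀, b, ψ₀, hZ⟩ := hF (prod T A) y z
  let ψ : pull (prod.map (SectionSpace.base b) (𝟙 A)) y ≅
      pull (prod.map (SectionSpace.base b) (𝟙 A)) z :=
    pullIso ψ₀ (SectionSpace.ev b) _ _ (SectionSpace.ev_comp b) (SectionSpace.ev_comp b)
  refine ⟨kify (SectionSpace b), SectionSpace.base b, ψ, fun S b' ψ' => ?_⟩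
  obtain ⟨h, ⟨hb, e⟩, hu⟩ := hZ (prod S A) (prod.map b' (𝟙 A)) ψ'
  have key : ∀ (k : S ⟶ kify (SectionSpace b)) (hk : k ≫ SectionSpace.base b = b'),
      pullMor (F := PretopStack.mappingStack A F) (x := y) (y := z) (a := SectionSpace.base b)
        (b := SectionSpace.base b) ψ.hom k b' b' hk hk =
      pullMor ψ₀.hom (prod.map k (𝟙 A) ≫ SectionSpace.ev b) (prod.map b' (𝟙 A))
        (prod.map b' (𝟙 A)) (by subst hk; rw [Category.assoc, SectionSpace.ev_comp]; rfl)
        (by subst hk; rw [Category.assoc, SectionSpace.ev_comp]; rfl) := by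
    intro k hk
    exact (pullMor_mappingStack (A := A) (F := F) _ _ _ _ _ _).trans
      (pullMor_pullMor ψ₀.hom (SectionSpace.ev b) _ _ (SectionSpace.ev_comp b)
        (SectionSpace.ev_comp b) _ _ _ _ _)
  refine ⟨SectionSpace.lift b b' h hb, ⟨rfl, (key _ rfl).trans e⟩, ?_⟩
  rintro k ⟨hk, e'⟩
  have hh : prod.map k (𝟙 A) ≫ SectionSpace.ev b = h :=
    hu _ ⟨by subst hk; rw [Category.assoc, SectionSpace.ev_comp]; rfl, (key k hk).symm.trans e'⟩
  ext s
  refine Subtype.ext (Prod.ext ?_ ?_)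
  · ext a
    exact congrArg (fun m => m (prod.mk s a)) hh
  · exact congrArg (fun m => m s) hk

end MappingDiagonal

/-! ### The groupoid of a chart -/

section ChartGroupoid

variable {F : CatPresheaf.{u, v, w}} {X E : Spc.{u}} {x : fib F X} {s t : E ⟶ X}
  {φ : pull s x ≅ pull t x}

theorem pointMap_comp {Y Z : Spc.{u}} (f : Y ⟶ Z) {y : Y} {z : Z} (h : f y = z) :
    pointMap y ≫ f = pointMap z := by
  subst h
  rfl

/-- The 2-isomorphism between two points of a chart that belongs to a point of the fibre product
of the chart with itself. -/
def arrowVal (φ : pull s x ≅ pull t x) (e : E) (p q : X) (hs : s e = p) (ht : t e = q) :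
    pull (pointMap p) x ⟶ pull (pointMap q) x :=
  pullMor φ.hom (pointMap e) (pointMap p) (pointMap q) (pointMap_comp s hs)
    (pointMap_comp t ht)

/-- This reduces the groupoid axioms, which are equalities of points of `E`, to identities between
isomorphisms over the one-point space. -/
theorem IsFiberProduct.eq_of_arrowVal (hE : IsFiberProduct x x s t φ) {e e' : E} (p q : X)
    (hs : s e = p) (ht : t e = q) (hs' : s e' = p) (ht' : t e' = q)
    (h : arrowVal φ e p q hs ht = arrowVal φ e' p q hs' ht') : e = e' :=
  congrArg (fun m => m PUnit.unit) (hE.hom_ext (l := pointMap e) (l' := pointMap e')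
    (pointMap p) (pointMap q) (pointMap_comp s hs) (pointMap_comp t ht)
    (pointMap_comp s hs') (pointMap_comp t ht') h)

/-- The fibre product of a chart with itself is a topological groupoid that presents the stack. -/
theorem IsFiberProduct.exists_presentation (hE : IsFiberProduct x x s t φ)
    (hx : IsEpimorphism x) :
    ∃ Γ : TopGroupoid.{u}, Nonempty (Presentation F Γ) := by
  -- Unit, inverse and composition classify the identity of `x`, the inverse of `φ`, and the
  -- composite of the two pullbacks of `φ`.
  obtain ⟨u, us, ut, hu⟩ := hE.exists_lift (𝟙 X) (𝟙 X) (Iso.refl _)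
  obtain ⟨i, is, it, hi⟩ := hE.exists_lift t s φ.symm
  have hcond : pb.snd t s ≫ s = pb.fst t s ≫ t := by
    ext p
    exact (pb.condition t s p).symm
  obtain ⟨m, ms, mt, hm⟩ := hE.exists_lift (pb.fst t s ≫ s) (pb.snd t s ≫ t)
    (pullIso φ (pb.fst t s) _ (pb.fst t s ≫ t) rfl rfl ≪≫
      pullIso φ (pb.snd t s) (pb.fst t s ≫ t) _ hcond rfl)
  have us' : ∀ a, s (u a) = a := fun a => congrArg (fun m => m a) us
  have ut' : ∀ a, t (u a) = a := fun a => congrArg (fun m => m a) ut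
  have is' : ∀ a, s (i a) = t a := fun a => congrArg (fun m => m a) is
  have it' : ∀ a, t (i a) = s a := fun a => congrArg (fun m => m a) it
  have ms' : ∀ (g h : E) (e : t g = s h), s (m (pb.mk g h e)) = s g :=
    fun g h e => congrArg (fun m => m (pb.mk g h e)) ms
  have mt' : ∀ (g h : E) (e : t g = s h), t (m (pb.mk g h e)) = t h :=
    fun g h e => congrArg (fun m => m (pb.mk g h e)) mt
  have mul : ∀ (T : Spc.{u}) (g h gh : T ⟶ E) (e : ∀ r, t (g r) = s (h r))
      (_ : ∀ r, gh r = m (pb.mk (g r) (h r) (e r)))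
      (a b c : T ⟶ X) (hga : g ≫ s = a) (hgb : g ≫ t = b) (hhb : h ≫ s = b)
      (hhc : h ≫ t = c) (hgha : gh ≫ s = a) (hghc : gh ≫ t = c),
      pullMor φ.hom gh a c hgha hghc =
        pullMor φ.hom g a b hga hgb ≫ pullMor φ.hom h b c hhb hhc := by
    intro T g h gh e hgh a b c hga hgb hhb hhc hgha hghc
    have e1 : pb.lift g h e ≫ m = gh := by
      ext r
      exact (hgh r).symm
    have ha : pb.lift g h e ≫ pb.fst t s ≫ s = a := hga
    have hb : pb.lift g h e ≫ pb.fst t s ≫ t = b := hgb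
    have hc : pb.lift g h e ≫ pb.snd t s ≫ t = c := hhc
    refine (pullMor_comp_of_eq hm (pb.lift g h e) e1 a c ha hc hgha hghc).trans ?_
    refine (pullMor_comp _ _ (pb.lift g h e) a b c ha hb hc).trans ?_
    have e2 := pullMor_pullMor φ.hom (pb.fst t s) (pb.fst t s ≫ s) (pb.fst t s ≫ t) rfl rfl
      (pb.lift g h e) a b ha hb
    have e3 := pullMor_pullMor φ.hom (pb.snd t s) (pb.fst t s ≫ t) (pb.snd t s ≫ t) hcond rfl
      (pb.lift g h e) b c hb hc
    exact congrArg₂ (· ≫ ·) e2 e3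
  -- The values at points of unit, inverse and composition are identities, inverses and composites
  -- of isomorphisms, so the axioms are inherited from the fibre of `F` over a point.
  have vmul : ∀ (g h : E) (e : t g = s h) (p q r : X) (hs : s g = p) (ht : t g = q) (hs' : s h = q)
      (ht' : t h = r) (hs'' : s (m (pb.mk g h e)) = p) (ht'' : t (m (pb.mk g h e)) = r),
      arrowVal φ (m (pb.mk g h e)) p r hs'' ht'' =
        arrowVal φ g p q hs ht ≫ arrowVal φ h q r hs' ht' := by
    intro g h e p q r h1 h2 h3 h4 h5 h6
    exact mul point (pointMap g) (pointMap h) (pointMap (m (pb.mk g h e))) (fun _ => e)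
      (fun _ => rfl) (pointMap p) (pointMap q) (pointMap r)
      (pointMap_comp s h1) (pointMap_comp t h2) (pointMap_comp s h3) (pointMap_comp t h4)
      (pointMap_comp s h5) (pointMap_comp t h6)
  have vone : ∀ (p : X) (hs : s (u p) = p) (ht : t (u p) = p), arrowVal φ (u p) p p hs ht = 𝟙 _ :=
    fun p h1 h2 => (pullMor_comp_of_eq hu (pointMap p) (l := pointMap (u p)) rfl _ _ rfl rfl
      (pointMap_comp s h1) (pointMap_comp t h2)).trans (pullMor_id _ _ _)
  have vinv : ∀ (e : E) (p q : X) (hs : s e = p) (ht : t e = q) (hs' : s (i e) = q)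
      (ht' : t (i e) = p), arrowVal φ (i e) q p hs' ht' =
        (pullIso φ (pointMap e) (pointMap p) (pointMap q) (pointMap_comp s hs)
          (pointMap_comp t ht)).inv :=
    fun e p q hs ht h1 h2 => pullMor_comp_of_eq hi (pointMap e) (l := pointMap (i e)) rfl _ _
      (pointMap_comp t ht) (pointMap_comp s hs) (pointMap_comp s h1) (pointMap_comp t h2)
  let Γ : TopGroupoid.{u} :=
    { obj := X
      arr := E
      src := s
      tgt := t
      unit := u
      inv := i
      comp := m
      src_unit := us'
      tgt_unit := ut'
      src_inv := is'
      tgt_inv := it'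
      src_comp := ms'
      tgt_comp := mt'
      unit_comp := by
        intro g
        refine hE.eq_of_arrowVal (s g) (t g) (ms' (u (s g)) g (ut' (s g)) |>.trans (us' _))
          (mt' (u (s g)) g (ut' (s g))) rfl rfl ?_
        rw [vmul (u (s g)) g (ut' (s g)) (s g) (s g) (t g) (us' _) (ut' _) rfl rfl, vone,
          Category.id_comp]
      comp_unit := by
        intro g
        refine hE.eq_of_arrowVal (s g) (t g) (ms' g (u (t g)) (us' (t g)).symm)
          (mt' g (u (t g)) (us' (t g)).symm |>.trans (ut' _)) rfl rfl ?_
        rw [vmul g (u (t g)) (us' (t g)).symm (s g) (t g) (t g) rfl rfl (us' _) (ut' _), vone,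
          Category.comp_id]
      comp_assoc := by
        intro f g h e e'
        have f1 : s (m (pb.mk f g e)) = s f := ms' f g e
        have f2 : t (m (pb.mk f g e)) = t g := mt' f g e
        have f3 : s (m (pb.mk g h e')) = s g := ms' g h e'
        have f4 : t (m (pb.mk g h e')) = t h := mt' g h e'
        refine hE.eq_of_arrowVal (s f) (t h)
          ((ms' (m (pb.mk f g e)) h (f2.trans e')).trans f1)
          (mt' (m (pb.mk f g e)) h (f2.trans e'))
          (ms' f (m (pb.mk g h e')) (e.trans f3.symm))
          ((mt' f (m (pb.mk g h e')) (e.trans f3.symm)).trans f4) ?_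
        rw [vmul (m (pb.mk f g e)) h (f2.trans e') (s f) (t g) (t h) f1 f2 e'.symm rfl,
          vmul f g e (s f) (t f) (t g) rfl rfl e.symm rfl,
          vmul f (m (pb.mk g h e')) (e.trans f3.symm) (s f) (t f) (t h) rfl rfl
            (f3.trans e.symm) f4,
          vmul g h e' (t f) (t g) (t h) e.symm rfl e'.symm rfl, Category.assoc]
      inv_comp := by
        intro g
        refine hE.eq_of_arrowVal (t g) (t g) ((ms' (i g) g (it' g)).trans (is' g))
          (mt' (i g) g (it' g)) (us' _) (ut' _) ?_
        rw [vone, vmul (i g) g (it' g) (t g) (s g) (t g) (is' g) (it' g) rfl rfl,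
          vinv g (s g) (t g) rfl rfl]
        exact (pullIso φ (pointMap g) (pointMap (s g)) (pointMap (t g)) rfl rfl).inv_hom_id
      comp_inv := by
        intro g
        refine hE.eq_of_arrowVal (s g) (s g) (ms' g (i g) (is' g).symm)
          ((mt' g (i g) (is' g).symm).trans (it' g)) (us' _) (ut' _) ?_
        rw [vone, vmul g (i g) (is' g).symm (s g) (t g) (s g) rfl rfl (is' g) (it' g),
          vinv g (s g) (t g) rfl rfl]
        exact (pullIso φ (pointMap g) (pointMap (s g)) (pointMap (t g)) rfl rfl).hom_inv_id }
  exact ⟨Γ, ⟨{ chart := x, epi := hx, φ := φ, cartesian := hE, cocycle := mul }⟩⟩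

theorem IsPretopological.exists_presentation (hF : IsPretopological F) :
    ∃ Γ : TopGroupoid.{u}, Nonempty (Presentation F Γ) := by
  obtain ⟨X, x, hx, hepi⟩ := hF.exists_chart
  obtain ⟨E, s, t, φ, hE⟩ := hx X x
  exact hE.exists_presentation hepi

end ChartGroupoid

/-! ### Objects from cocycles with values in a presentation -/

section Torsor

universe t

/-- Objects of the stack from cocycles with values in a groupoid presentation. -/
theorem Presentation.exists_of_cocycle {F : CatPresheaf.{u, v, w}} (hF : IsTopStack F)
    {Γ : TopGroupoid.{u}} (P : Presentation F Γ) {ι : Type t} {T : Spc.{u}} {W : ι → Spc.{u}}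
    {q : ∀ i, W i ⟶ T} (hq : IsCover q) (a : ∀ i, W i ⟶ Γ.obj)
    (γ : ∀ i j (S : Spc.{u}) (f : S ⟶ W i) (g : S ⟶ W j), f ≫ q i = g ≫ q j → (S ⟶ Γ.arr))
    (hsrc : ∀ i j (S : Spc.{u}) (f : S ⟶ W i) (g : S ⟶ W j) (h : f ≫ q i = g ≫ q j),
      γ i j S f g h ≫ Γ.src = f ≫ a i)
    (htgt : ∀ i j (S : Spc.{u}) (f : S ⟶ W i) (g : S ⟶ W j) (h : f ≫ q i = g ≫ q j),
      γ i j S f g h ≫ Γ.tgt = g ≫ a j)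
    (hnat : ∀ i j (S S' : Spc.{u}) (f : S ⟶ W i) (g : S ⟶ W j) (h : f ≫ q i = g ≫ q j)
      (k : S' ⟶ S), k ≫ γ i j S f g h =
        γ i j S' (k ≫ f) (k ≫ g) (by rw [Category.assoc, Category.assoc, h]))
    (hcomp : ∀ i j l (S : Spc.{u}) (f : S ⟶ W i) (g : S ⟶ W j) (e : S ⟶ W l)
      (h : f ≫ q i = g ≫ q j) (h' : g ≫ q j = e ≫ q l) (s : S)
      (c : Γ.tgt (γ i j S f g h s) = Γ.src (γ j l S g e h' s)),
      γ i l S f e (h.trans h') s = Γ.comp (pb.mk (γ i j S f g h s) (γ j l S g e h' s) c)) :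
    ∃ (ρ : fib F T) (θ : ∀ i, pull (q i) ρ ≅ pull (a i) P.chart),
      ∀ i j (S : Spc.{u}) (f : S ⟶ W i) (g : S ⟶ W j) (h : f ≫ q i = g ≫ q j),
        pullMor (θ i).hom f (f ≫ q i) (f ≫ a i) rfl rfl ≫
          pullMor P.φ.hom (γ i j S f g h) (f ≫ a i) (g ≫ a j) (hsrc i j S f g h)
            (htgt i j S f g h) =
          pullMor (θ j).hom g (f ≫ q i) (g ≫ a j) h.symm rfl := by
  refine exists_descent_object hF hq (fun _ => P.chart) a
    (fun i j S f g h => pullMor P.φ.hom (γ i j S f g h) (f ≫ a i) (g ≫ a j) (hsrc i j S f g h)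
            (htgt i j S f g h)) ?_ ?_
  · intro i j S S' f g h k
    exact (pullMor_pullMor _ _ _ _ _ _ _ _ _ _ _).trans (pullMor_congr _ (hnat i j S S' f g h k)
      _ _ _ _)
  · intro i j l S f g e h h'
    have hst : ∀ s, Γ.tgt (γ i j S f g h s) = Γ.src (γ j l S g e h' s) := fun s =>
      congrArg (fun m => m s) ((htgt i j S f g h).trans (hsrc j l S g e h').symm)
    exact (P.cocycle S _ _ _ hst (fun s => hcomp i j l S f g e h h' s (hst s)) _ _ _ _ _ _ _ _
      _).symm

end Torsor

/-! ### The universal object over the space of groupoid morphisms -/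

section Universal

variable {A : Spc.{u}} {Γ : TopGroupoid.{u}}

/-- The value of the universal groupoid morphism at two points of the disjoint union, over all
covers, with the same image. -/
def universalArr {α : FiniteOpenCover A} (φ : homSpace (coverGroupoid A α.1) Γ)
    (x : coverSpace A α.1) : ∀ {β : FiniteOpenCover A} (ψ : homSpace (coverGroupoid A β.1) Γ)
    (y : coverSpace A β.1), coverHomSpaceIncl A Γ α φ = coverHomSpaceIncl A Γ β ψ →
      coverMap A α.1 x = coverMap A β.1 y → Γ.arr
  | _, _, y, rfl, h => (kify.val φ).onArr (pb.mk x y h)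

theorem src_universalArr {α β : FiniteOpenCover A} (φ : homSpace (coverGroupoid A α.1) Γ)
    (x : coverSpace A α.1) (ψ : homSpace (coverGroupoid A β.1) Γ)
    (y : coverSpace A β.1) (h : coverHomSpaceIncl A Γ α φ = coverHomSpaceIncl A Γ β ψ)
    (h' : coverMap A α.1 x = coverMap A β.1 y) :
    Γ.src (universalArr φ x ψ y h h') = (kify.val φ).onObj x := by
  cases h
  exact (kify.val φ).src_eq _

theorem tgt_universalArr {α β : FiniteOpenCover A} (φ : homSpace (coverGroupoid A α.1) Γ)
    (x : coverSpace A α.1) (ψ : homSpace (coverGroupoid A β.1) Γ)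
    (y : coverSpace A β.1) (h : coverHomSpaceIncl A Γ α φ = coverHomSpaceIncl A Γ β ψ)
    (h' : coverMap A α.1 x = coverMap A β.1 y) :
    Γ.tgt (universalArr φ x ψ y h h') = (kify.val ψ).onObj y := by
  cases h
  exact (kify.val φ).tgt_eq _

theorem comp_universalArr {α β δ : FiniteOpenCover A} (φ : homSpace (coverGroupoid A α.1) Γ)
    (x : coverSpace A α.1) (ψ : homSpace (coverGroupoid A β.1) Γ)
    (y : coverSpace A β.1) (χ : homSpace (coverGroupoid A δ.1) Γ)
    (z : coverSpace A δ.1) (h : coverHomSpaceIncl A Γ α φ = coverHomSpaceIncl A Γ β ψ)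
    (h' : coverMap A α.1 x = coverMap A β.1 y)
    (k : coverHomSpaceIncl A Γ β ψ = coverHomSpaceIncl A Γ δ χ)
    (k' : coverMap A β.1 y = coverMap A δ.1 z)
    (c : Γ.tgt (universalArr φ x ψ y h h') = Γ.src (universalArr ψ y χ z k k')) :
    universalArr φ x χ z (h.trans k) (h'.trans k') =
      Γ.comp (pb.mk (universalArr φ x ψ y h h') (universalArr ψ y χ z k k') c) := by
  cases h
  cases k
  exact (kify.val φ).comp_eq (pb.mk x y h') (pb.mk y z k') rfl

/-- Summands of a coproduct are disjoint, so a single point of `S` forces `α = β`, after which the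
map is evaluation of the universal morphism. An empty `S` gives no such equality and is treated
apart. -/
theorem continuous_universalArr {α β : FiniteOpenCover A} {S : Spc.{u}}
    (φ : S ⟶ homSpace (coverGroupoid A α.1) Γ) (x : S ⟶ coverSpace A α.1)
    (ψ : S ⟶ homSpace (coverGroupoid A β.1) Γ) (y : S ⟶ coverSpace A β.1)
    (h : ∀ s, coverHomSpaceIncl A Γ α (φ s) = coverHomSpaceIncl A Γ β (ψ s))
    (h' : ∀ s, coverMap A α.1 (x s) = coverMap A β.1 (y s)) :
    Continuous (fun s => universalArr (φ s) (x s) (ψ s) (y s) (h s) (h' s)) := by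
  by_cases hS : Nonempty S
  · obtain ⟨s₀⟩ := hS
    obtain rfl : α = β := congrArg Sigma.fst (h s₀)
    obtain rfl : φ = ψ := by
      ext s
      exact eq_of_heq (Sigma.mk.inj (h s)).2
    exact continuous_hom (prod.lift φ (pb.lift x y h') ≫ evArr (coverGroupoid A α.1) Γ)
  · have : IsEmpty S := not_nonempty_iff.1 hS
    exact continuous_of_const fun s => isEmptyElim s

/-- Near a point of the summand `α` lying over `a ∈ U ∈ α`, a local section places the second
coordinate in the sheet `U`. -/
theorem isCover_coverHomSpace (A : Spc.{u}) (Γ : TopGroupoid.{u}) :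
    IsCover (fun α : FiniteOpenCover A =>
      prod.map (coverHomSpaceIncl A Γ α) (coverMap A α.1)) := by
  refine isCover_of_local_sections fun p => ?_
  obtain ⟨⟨⟨α, f⟩, a⟩, rfl⟩ : ∃ c : (Σ α : FiniteOpenCover A, homSpace (coverGroupoid A α.1) Γ) × A,
    (prod.mk (X := coverHomSpace A Γ) c.1 c.2) = p := ⟨p, rfl⟩
  obtain ⟨U, hU, ha⟩ : ∃ U ∈ α.1, a ∈ U := by
    have : a ∈ sSup α.1 := by rw [α.2.2]; trivial
    simpa using this
  let e : homSpace (coverGroupoid A α.1) Γ → coverHomSpace A Γ := coverHomSpaceIncl A Γ α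
  have he : Topology.IsOpenEmbedding e :=
    Topology.IsOpenEmbedding.sigmaMk (σ := fun α : FiniteOpenCover A =>
      (homSpace (coverGroupoid A α.1) Γ : Type u)) (i := α)
  let O : Opens (prod (coverHomSpace A Γ) A) :=
    ⟨prod.fst _ _ ⁻¹' Set.range e ∩ prod.snd _ _ ⁻¹' U,
      (he.isOpen_range.preimage (continuous_hom (prod.fst _ _))).inter
        (U.isOpen.preimage (continuous_hom (prod.snd _ _)))⟩
  let l₁ : CompactlyGenerated.of.{u, u} O ⟶ homSpace (coverGroupoid A α.1) Γ :=
    mkHom (fun o => he.isEmbedding.toHomeomorph.symm ⟨prod.fst _ _ o.1, o.2.1⟩)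
      (he.isEmbedding.toHomeomorph.symm.continuous.comp
        (((continuous_hom (prod.fst _ _)).comp continuous_subtype_val).subtype_mk _))
  let l₂ : CompactlyGenerated.of.{u, u} O ⟶ coverSpace A α.1 :=
    mkHom (Y := coverSpace A α.1)
      (fun o => (⟨⟨U, hU⟩, ⟨prod.snd _ _ o.1, o.2.2⟩⟩ : Σ U : α.1, (U : Opens A)))
      ((continuous_sigmaMk (σ := fun U : α.1 => ((U : Opens A) : Type u)) (i := ⟨U, hU⟩)).comp
        (((continuous_hom (prod.snd _ _)).comp continuous_subtype_val).subtype_mk _))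
  refine ⟨O, ⟨⟨f, rfl⟩, ha⟩, α, prod.lift l₁ l₂, fun o => ?_⟩
  exact congrArg (fun m => (prod.mk m (prod.snd _ _ o.1) : prod (coverHomSpace A Γ) A))
    (congrArg Subtype.val (he.isEmbedding.toHomeomorph.apply_symm_apply
      ⟨prod.fst _ _ o.1, o.2.1⟩))

theorem lift_evArr_src {Y X : TopGroupoid.{u}} {S : Spc.{u}} (φ : S ⟶ homSpace Y X)
    (g : S ⟶ Y.arr) (x : S ⟶ Y.obj) (h : g ≫ Y.src = x) :
    (prod.lift φ g ≫ evArr Y X) ≫ X.src = prod.lift φ x ≫ evObj Y X := by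
  subst h
  rw [Category.assoc, evArr_src]
  rfl

theorem lift_evArr_tgt {Y X : TopGroupoid.{u}} {S : Spc.{u}} (φ : S ⟶ homSpace Y X)
    (g : S ⟶ Y.arr) (x : S ⟶ Y.obj) (h : g ≫ Y.tgt = x) :
    (prod.lift φ g ≫ evArr Y X) ≫ X.tgt = prod.lift φ x ≫ evObj Y X := by
  subst h
  rw [Category.assoc, evArr_tgt]
  rfl

/-- The compatibility of local trivializations `θ` of the object `r` with the universal groupoid
morphism on the cover `α`. -/
def IsUniversalTrivialization {F : CatPresheaf.{u, v, w}} (P : Presentation F Γ)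
    (r : fib F (prod (coverHomSpace A Γ) A)) (α : FiniteOpenCover A)
    (θ : pull (prod.map (coverHomSpaceIncl A Γ α) (coverMap A α.1)) r ≅
      pull (evObj (coverGroupoid A α.1) Γ) P.chart) : Prop :=
  ∀ (S : Spc.{u}) (φ : S ⟶ homSpace (coverGroupoid A α.1) Γ) (x : S ⟶ (coverGroupoid A α.1).obj)
    (y : S ⟶ (coverGroupoid A α.1).obj) (g : S ⟶ (coverGroupoid A α.1).arr)
    (hx : g ≫ (coverGroupoid A α.1).src = x) (hy : g ≫ (coverGroupoid A α.1).tgt = y)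
    (c : S ⟶ A) (hcx : x ≫ coverMap A α.1 = c) (hcy : y ≫ coverMap A α.1 = c)
    (a b : S ⟶ Γ.obj) (ha : prod.lift φ x ≫ evObj _ _ = a) (hb : prod.lift φ y ≫ evObj _ _ = b),
    pullMor θ.hom (prod.lift φ x) (prod.lift (φ ≫ coverHomSpaceIncl A Γ α) c) a
        (by subst hcx; rfl) ha ≫
      pullMor P.φ.hom (prod.lift φ g ≫ evArr _ _) a b ((lift_evArr_src _ _ _ hx).trans ha)
        ((lift_evArr_tgt _ _ _ hy).trans hb) =
    pullMor θ.hom (prod.lift φ y) (prod.lift (φ ≫ coverHomSpaceIncl A Γ α) c) b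
        (by subst hcy; rfl) hb

/-- Two points of `U_α` over the same point of `A` form an arrow of the cover groupoid, and the
universal morphism sends it to the transition arrow in `Γ`. Compatibility of groupoid morphisms with
composition is the cocycle condition. -/
theorem Presentation.exists_universal {F : CatPresheaf.{u, v, w}} (hF : IsTopStack F)
    (P : Presentation F Γ) (A : Spc.{u}) :
    ∃ (r : fib F (prod (coverHomSpace A Γ) A))
      (θ : ∀ α : FiniteOpenCover A,
        pull (prod.map (coverHomSpaceIncl A Γ α) (coverMap A α.1)) r ≅
          pull (evObj (coverGroupoid A α.1) Γ) P.chart),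
      ∀ α, IsUniversalTrivialization P r α (θ α) := by
  have h1 : ∀ (α β : FiniteOpenCover A) (S : Spc.{u})
      (f : S ⟶ prod (homSpace (coverGroupoid A α.1) Γ) (coverSpace A α.1))
      (g : S ⟶ prod (homSpace (coverGroupoid A β.1) Γ) (coverSpace A β.1))
      (_ : f ≫ prod.map (coverHomSpaceIncl A Γ α) (coverMap A α.1) =
        g ≫ prod.map (coverHomSpaceIncl A Γ β) (coverMap A β.1)) (s : S),
      coverHomSpaceIncl A Γ α (prod.fst _ _ (f s)) = coverHomSpaceIncl A Γ β (prod.fst _ _ (g s)) :=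
    fun α β S f g h s => congrArg (fun m => prod.fst _ _ (m s)) h
  have h2 : ∀ (α β : FiniteOpenCover A) (S : Spc.{u})
      (f : S ⟶ prod (homSpace (coverGroupoid A α.1) Γ) (coverSpace A α.1))
      (g : S ⟶ prod (homSpace (coverGroupoid A β.1) Γ) (coverSpace A β.1))
      (_ : f ≫ prod.map (coverHomSpaceIncl A Γ α) (coverMap A α.1) =
        g ≫ prod.map (coverHomSpaceIncl A Γ β) (coverMap A β.1)) (s : S),
      coverMap A α.1 (prod.snd _ _ (f s)) = coverMap A β.1 (prod.snd _ _ (g s)) :=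
    fun α β S f g h s => congrArg (fun m => prod.snd _ _ (m s)) h
  obtain ⟨r, θ, hθ⟩ := P.exists_of_cocycle hF (isCover_coverHomSpace A Γ)
    (fun α => evObj (coverGroupoid A α.1) Γ)
    (fun α β S f g h => mkHom _ (continuous_universalArr (f ≫ prod.fst _ _) (f ≫ prod.snd _ _)
      (g ≫ prod.fst _ _) (g ≫ prod.snd _ _) (h1 α β S f g h) (h2 α β S f g h)))
    (fun α β S f g h => by
      ext s
      exact src_universalArr _ _ _ _ (h1 α β S f g h s) (h2 α β S f g h s))
    (fun α β S f g h => by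
      ext s
      exact tgt_universalArr _ _ _ _ (h1 α β S f g h s) (h2 α β S f g h s))
    (fun _ _ _ _ _ _ _ _ => rfl)
    (fun α β δ S f g e h h' s c => comp_universalArr _ _ _ _ _ _ (h1 α β S f g h s)
      (h2 α β S f g h s) (h1 β δ S g e h' s) (h2 β δ S g e h' s) c)
  refine ⟨r, θ, fun α S φ x y g hx hy c hcx hcy a b ha hb => ?_⟩
  subst hx hy hcx ha hb
  exact hθ α α S (prod.lift φ (g ≫ (coverGroupoid A α.1).src))
    (prod.lift φ (g ≫ (coverGroupoid A α.1).tgt)) (congrArg (prod.lift (φ ≫ coverHomSpaceIncl A Γ α)) hcy.symm)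

/-- The case of the tautological maps on `R_α × (U_α ×_A U_α)`. What remains is to move the
identification of iterated pullbacks out of both sides. -/
theorem IsUniversalTrivialization.isUniversalMorphism {F : CatPresheaf.{u, v, w}}
    {P : Presentation F Γ} {r : fib F (prod (coverHomSpace A Γ) A)} {α : FiniteOpenCover A}
    {θ : pull (prod.map (coverHomSpaceIncl A Γ α) (coverMap A α.1)) r ≅
      pull (evObj (coverGroupoid A α.1) Γ) P.chart}
    (h : IsUniversalTrivialization P r α θ) :
    IsUniversalMorphism P A α.1 (pull (F := F) (prod.map (coverHomSpaceIncl A Γ α) (𝟙 A)) r) := by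
  let R := homSpace (coverGroupoid A α.1) Γ
  refine ⟨pullPull (prod.map (𝟙 R) (coverMap A α.1)) (prod.map (coverHomSpaceIncl A Γ α) (𝟙 A))
    (prod.map (coverHomSpaceIncl A Γ α) (coverMap A α.1)) rfl r ≪≫ θ, ?_⟩
  have e := h _ (prod.fst R (coverGroupoid A α.1).arr)
    (prod.snd R (coverGroupoid A α.1).arr ≫ (coverGroupoid A α.1).src)
    (prod.snd R (coverGroupoid A α.1).arr ≫ (coverGroupoid A α.1).tgt)
    (prod.snd R (coverGroupoid A α.1).arr) rfl rfl _ rfl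
    (by ext p; exact (pb.condition _ _ (prod.snd R (coverGroupoid A α.1).arr p)).symm) _ _ (evArr_src _ _).symm (evArr_tgt _ _).symm
  have hq : prod.map (𝟙 R) (coverGroupoid A α.1).tgt ≫
      prod.map (coverHomSpaceIncl A Γ α) (coverMap A α.1) =
      prod.lift (prod.fst R (coverGroupoid A α.1).arr ≫ coverHomSpaceIncl A Γ α)
        ((prod.snd R (coverGroupoid A α.1).arr ≫ (coverGroupoid A α.1).src) ≫ coverMap A α.1) := by
    ext p
    exact congrArg (prod.mk (Y := A) (coverHomSpaceIncl A Γ α (prod.fst _ _ p)))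
      (pb.condition _ _ (prod.snd R (coverGroupoid A α.1).arr p)).symm
  refine (congrArg (· ≫ _) (pullMor_pullPull_comp (prod.map (𝟙 R) (coverMap A α.1))
    (prod.map (coverHomSpaceIncl A Γ α) (𝟙 A))
    (prod.map (coverHomSpaceIncl A Γ α) (coverMap A α.1)) rfl θ.hom _ _ _ _ rfl rfl _)).trans ?_
  refine Eq.trans ?_ (pullMor_pullPull_comp (prod.map (𝟙 R) (coverMap A α.1))
    (prod.map (coverHomSpaceIncl A Γ α) (𝟙 A))
    (prod.map (coverHomSpaceIncl A Γ α) (coverMap A α.1)) rfl θ.hom _ _ _ _ _ hq _).symm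
  rw [Category.assoc]
  exact congrArg (_ ≫ ·) e

end Universal

/-! ### Covers of the second factor, and local continuity -/

section ProductCover

universe t

theorem IsCover.prod_map_right {ι : Type t} {T A : Spc.{u}} {W : ι → Spc.{u}} {q : ∀ i, W i ⟶ A}
    (h : IsCover q) : IsCover (fun i => prod.map (𝟙 T) (q i)) := by
  refine isCover_of_local_sections fun p => ?_
  obtain ⟨O, hO, i, s, hs⟩ := h.exists_local_section (prod.snd T A p)
  let O' : Opens (prod T A) := ⟨prod.snd T A ⁻¹' O, O.isOpen.preimage (continuous_hom _)⟩
  refine ⟨O', hO, i, prod.lift (openIncl O' ≫ prod.fst T A)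
    (openRestrict (prod.snd T A) O O' (fun _ h => h) ≫ s), fun o => ?_⟩
  exact congrArg (prod.mk (prod.fst T A o.1)) (hs ⟨prod.snd T A o.1, o.2⟩)

/-- Continuity is local for covers. -/
theorem IsCover.continuous {ι : Type t} {T : Spc.{u}} {W : ι → Spc.{u}} {q : ∀ i, W i ⟶ T}
    (h : IsCover q) {Y : Type*} [TopologicalSpace Y] (f : T → Y)
    (hf : ∀ i, Continuous (fun w => f (q i w))) : Continuous f := by
  rw [continuous_iff_continuousAt]
  intro x
  obtain ⟨O, hO, i, s, hs⟩ := h.exists_local_section x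
  have h1 : Continuous (fun o : O => f o.1) := by
    have h2 : (fun o : O => f o.1) = fun o => f (q i (s o)) := funext fun o => by rw [hs]
    rw [h2]
    exact (hf i).comp (continuous_hom s)
  exact (O.isOpen.isOpenEmbedding_subtypeVal.continuousAt_iff (x := ⟨x, hO⟩)).1 h1.continuousAt

end ProductCover

/-! ### Topology of the cover groupoid -/

section CoverSpace

variable {A : Spc.{u}} {α : Set (Opens A)}

/-- The inclusion of a member of an open cover into the disjoint union. -/
def coverSpaceIncl (U : α) : CompactlyGenerated.of.{u, u} (U : Opens A) ⟶ coverSpace A α :=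
  mkHom (Y := coverSpace A α) (fun x => (⟨U, x⟩ : Σ U : α, (U : Opens A)))
    (continuous_sigmaMk (σ := fun U : α => ((U : Opens A) : Type u)) (i := U))

theorem isCover_coverSpaceIncl : IsCover (fun U : α => coverSpaceIncl U) := by
  rintro ⟨U, x⟩
  refine ⟨_, coverSpaceIncl U, Topology.IsOpenEmbedding.sigmaMk
    (σ := fun U : α => ((U : Opens A) : Type u)) (i := U), ⟨x, rfl⟩, ?_⟩
  rw [Sieve.mem_ofArrows_iff]
  exact ⟨U, 𝟙 _, rfl⟩

theorem isCover_coverMap (hα : sSup α = ⊤) : IsCover (fun _ : Unit => coverMap A α) := by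
  refine isCover_of_local_sections fun a => ?_
  obtain ⟨U, hU, ha⟩ : ∃ U ∈ α, a ∈ U := by
    have : a ∈ sSup α := by rw [hα]; trivial
    simpa using this
  exact ⟨U, ha, (), coverSpaceIncl ⟨U, hU⟩, fun _ => rfl⟩

instance [T2Space A] : T2Space (coverSpace A α) :=
  inferInstanceAs (T2Space (Σ U : α, (U : Opens A)))

instance [LocallyCompactSpace A] : LocallyCompactSpace (coverSpace A α) := by
  refine ⟨?_⟩
  rintro ⟨U, x⟩ N hN
  have : LocallyCompactSpace (U : Opens A) := U.1.isOpen.locallyCompactSpace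
  let e : ((U : Opens A) : Type u) → Σ U : α, ((U : Opens A) : Type u) := fun x => ⟨U, x⟩
  have he : Topology.IsOpenEmbedding e := Topology.IsOpenEmbedding.sigmaMk
    (σ := fun U : α => ((U : Opens A) : Type u)) (i := U)
  obtain ⟨K, hK, hKN, hKc⟩ := local_compact_nhds (he.continuous.continuousAt.preimage_mem_nhds hN)
  refine ⟨e '' K, ?_, Set.image_subset_iff.2 hKN, hKc.image he.continuous⟩
  exact he.isOpenMap.image_mem_nhds hK

/-- This is where Hausdorffness of `A` makes `U_α ×_A U_α` locally compact, so that the exponential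
law applies to arrows as well as to objects. -/
theorem isClosed_coverSpace [T2Space A] :
    IsClosed {p : coverSpace A α × coverSpace A α | coverMap A α p.1 = coverMap A α p.2} :=
  isClosed_eq ((continuous_hom (coverMap A α)).comp continuous_fst)
    ((continuous_hom (coverMap A α)).comp continuous_snd)

/-- The topology of `U_α ×_A U_α` is the subspace topology. -/
def coverGroupoid.arrHomeomorph [LocallyCompactSpace A] [T2Space A] :
    (coverGroupoid A α).arr ≃ₜ
      {p : coverSpace A α × coverSpace A α // coverMap A α p.1 = coverMap A α p.2} :=
  have : LocallyCompactSpace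
    {p : coverSpace A α × coverSpace A α // coverMap A α p.1 = coverMap A α p.2} :=
    (isClosed_coverSpace (A := A) (α := α)).isClosedEmbedding_subtypeVal.locallyCompactSpace
  kify.homeomorph _

instance [LocallyCompactSpace A] [T2Space A] : T2Space (coverGroupoid A α).arr :=
  (coverGroupoid.arrHomeomorph (A := A) (α := α)).symm.t2Space

instance [LocallyCompactSpace A] [T2Space A] : LocallyCompactSpace (coverGroupoid A α).arr :=
  have : LocallyCompactSpace
    {p : coverSpace A α × coverSpace A α // coverMap A α p.1 = coverMap A α p.2} :=
    (isClosed_coverSpace (A := A) (α := α)).isClosedEmbedding_subtypeVal.locallyCompactSpace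
  (coverGroupoid.arrHomeomorph (A := A) (α := α)).isClosedEmbedding.locallyCompactSpace

instance [LocallyCompactSpace A] [T2Space A] : T2Space (coverGroupoid A α).obj :=
  inferInstanceAs (T2Space (coverSpace A α))

instance [LocallyCompactSpace A] : LocallyCompactSpace (coverGroupoid A α).obj :=
  inferInstanceAs (LocallyCompactSpace (coverSpace A α))

end CoverSpace

/-! ### Sections over boxes and compactness -/

section Tube

variable {T A Q : Spc.{u}} {b : Q ⟶ prod T A}

/-- The map `b` has a section over the box `V × U`. -/
def HasSectionOver (b : Q ⟶ prod T A) (V : Opens T) (U : Opens A) : Prop :=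
  ∃ s : prod (CompactlyGenerated.of.{u, u} V) (CompactlyGenerated.of.{u, u} U) ⟶ Q,
    s ≫ b = prod.map (openIncl V) (openIncl U)

theorem HasSectionOver.mono {V V' : Opens T} {U : Opens A} (h : HasSectionOver b V U)
    (hV : V' ≤ V) : HasSectionOver b V' U := by
  obtain ⟨s, hs⟩ := h
  refine ⟨prod.map (openRestrict (𝟙 T) V V' hV) (𝟙 _) ≫ s, ?_⟩
  rw [Category.assoc, hs]
  rfl

/-- Open boxes form a basis of `T × A` because the compactly generated product with the locally
compact Hausdorff space `A` has the ordinary product topology. -/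
theorem IsCover.exists_hasSectionOver [LocallyCompactSpace A] [T2Space A]
    (hb : IsCover (fun _ : Unit => b)) (t : T) (a : A) :
    ∃ (V : Opens T) (U : Opens A), t ∈ V ∧ a ∈ U ∧ HasSectionOver b V U := by
  obtain ⟨O, hO, -, s, hs⟩ := hb.exists_local_section (prod.mk t a)
  obtain ⟨V, U, hV, hU, htV, haU, hVU⟩ := isOpen_prod_iff.1
    (O.isOpen.preimage (prod.continuous_mk T A)) t a hO
  refine ⟨⟨V, hV⟩, ⟨U, hU⟩, htV, haU, mkHom (Y := CompactlyGenerated.of.{u, u} O) (fun p => ⟨prod.mk (kify.val p).1.1 (kify.val p).2.1,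
    hVU (Set.mk_mem_prod (kify.val p).1.2 (kify.val p).2.2)⟩)
    ((continuous_hom (prod.map (openIncl ⟨V, hV⟩) (openIncl ⟨U, hU⟩))).subtype_mk _) ≫ s, ?_⟩
  ext p
  exact hs _

/-- A cover of `T × A`, with `A` compact, has sections over finitely many boxes `V × U` that
cover a neighbourhood of `{t} × A`. -/
theorem IsCover.exists_section_coverSpace [LocallyCompactSpace A] [T2Space A] [CompactSpace A]
    (hb : IsCover (fun _ : Unit => b)) (t : T) :
    ∃ (V : Opens T) (_ : t ∈ V) (α : FiniteOpenCover A)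
      (s : prod (CompactlyGenerated.of.{u, u} V) (coverSpace A α.1) ⟶ Q),
      s ≫ b = prod.map (openIncl V) (coverMap A α.1) := by
  choose V U htV haU h using hb.exists_hasSectionOver t
  obtain ⟨I, hI⟩ := isCompact_univ.elim_finite_subcover (fun a : A => (U a : Set A))
    (fun a => (U a).isOpen) (fun a _ => Set.mem_iUnion.2 ⟨a, haU a⟩)
  let α : FiniteOpenCover A := ⟨U '' I, I.finite_toSet.image U, by
    rw [eq_top_iff]
    intro a _
    obtain ⟨i, hi, ha⟩ := Set.mem_iUnion₂.1 (hI (Set.mem_univ a))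
    exact Opens.mem_sSup.2 ⟨U i, ⟨i, hi, rfl⟩, ha⟩⟩
  -- One section is chosen for each member of `α`, not for each index in `I`, since several indices
  -- may give the same open set. For empty `A` the infimum over the empty `I` is `⊤`.
  have hα : ∀ W : α.1, HasSectionOver b (I.inf V) W := by
    rintro ⟨W, i, hi, rfl⟩
    exact (h i).mono (Finset.inf_le hi)
  choose s hs using hα
  have hcov := (isCover_coverSpaceIncl (A := A) (α := α.1)).prod_map_right
    (T := CompactlyGenerated.of.{u, u} (I.inf V : Opens T))
  refine ⟨I.inf V, ?_, α, mkHom (fun p => s (kify.val p).2.1 (prod.mk (kify.val p).1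
    (kify.val p).2.2)) (hcov.continuous _ fun W => continuous_hom (s W)), ?_⟩
  · rw [← SetLike.mem_coe, Opens.coe_finset_inf]
    simpa using fun a _ => htV a
  · ext p
    exact congrArg (fun m => m (prod.mk (kify.val p).1 (kify.val p).2.2)) (hs (kify.val p).2.1)

end Tube

/-! ### Trivialized objects are classified by groupoid morphisms -/

section Classify

variable {F : CatPresheaf.{u, v, w}} {Γ : TopGroupoid.{u}} {T V A : Spc.{u}}

/-- A trivialization of a family of objects along an open cover `α` of `A` gives a family of
groupoid morphisms from the groupoid of `α`. -/
theorem Presentation.exists_family [LocallyCompactSpace A] [T2Space A] (P : Presentation F Γ)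
    (α : Set (Opens A)) {y : fib F (prod T A)} (i : V ⟶ T)
    (e : prod V (coverGroupoid A α).obj ⟶ Γ.obj)
    (ν : pull e P.chart ≅ pull (prod.map i (coverMap A α)) y) :
    ∃ (σ : V ⟶ homSpace (coverGroupoid A α) Γ)
      (he : prod.map σ (𝟙 _) ≫ evObj (coverGroupoid A α) Γ = e),
      ∀ (S : Spc.{u}) (l : S ⟶ V) (g : S ⟶ (coverGroupoid A α).arr)
        (x z : S ⟶ (coverGroupoid A α).obj) (hx : g ≫ (coverGroupoid A α).src = x)
        (hz : g ≫ (coverGroupoid A α).tgt = z) (a b : S ⟶ Γ.obj)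
        (ha : prod.lift l x ≫ e = a) (hb : prod.lift l z ≫ e = b) (c : S ⟶ prod T A)
        (hcx : prod.lift l x ≫ prod.map i (coverMap A α) = c)
        (hcz : prod.lift l z ≫ prod.map i (coverMap A α) = c),
        pullMor P.φ.hom (prod.lift (l ≫ σ) g ≫ evArr _ _) a b
          ((lift_evArr_src _ _ _ hx).trans (by rw [← ha, ← he]; rfl))
          ((lift_evArr_tgt _ _ _ hz).trans (by rw [← hb, ← he]; rfl)) ≫
          pullMor ν.hom (prod.lift l z) b c hb hcz =
        pullMor ν.hom (prod.lift l x) a c ha hcx := by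
  let D := prod V (coverGroupoid A α).arr
  let xD : D ⟶ prod V (coverGroupoid A α).obj := prod.map (𝟙 V) (coverGroupoid A α).src
  let zD : D ⟶ prod V (coverGroupoid A α).obj := prod.map (𝟙 V) (coverGroupoid A α).tgt
  have hD : zD ≫ prod.map i (coverMap A α) = xD ≫ prod.map i (coverMap A α) := by
    ext p
    exact congrArg (prod.mk (i (kify.val p).1)) (pb.condition _ _ (kify.val p).2).symm
  -- The map `d` classifies the transition of the trivialization: `ν` at the source of the arrow
  -- followed by the inverse of `ν` at the target.
  obtain ⟨d, ds, dt, hd⟩ := P.cartesian.exists_lift (xD ≫ e) (zD ≫ e)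
    (pullIso ν xD (xD ≫ e) (xD ≫ prod.map i (coverMap A α)) rfl rfl ≪≫
      (pullIso ν zD (zD ≫ e) (xD ≫ prod.map i (coverMap A α)) rfl hD).symm)
  have key : ∀ (S : Spc.{u}) (l : S ⟶ V) (g : S ⟶ (coverGroupoid A α).arr)
        (x z : S ⟶ (coverGroupoid A α).obj) (hx : g ≫ (coverGroupoid A α).src = x)
        (hz : g ≫ (coverGroupoid A α).tgt = z) (a b : S ⟶ Γ.obj)
        (ha : prod.lift l x ≫ e = a) (hb : prod.lift l z ≫ e = b) (c : S ⟶ prod T A)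
        (hcx : prod.lift l x ≫ prod.map i (coverMap A α) = c)
        (hcz : prod.lift l z ≫ prod.map i (coverMap A α) = c)
        (has : (prod.lift l g ≫ d) ≫ Γ.src = a) (hbt : (prod.lift l g ≫ d) ≫ Γ.tgt = b),
        pullMor P.φ.hom (prod.lift l g ≫ d) a b has hbt =
          pullMor ν.hom (prod.lift l x) a c ha hcx ≫
            pullMor ν.inv (prod.lift l z) c b hcz hb := by
    intro S l g x z hx hz a b ha hb c hcx hcz has hbt
    subst hx hz ha hb hcx
    refine (pullMor_comp_of_eq hd (prod.lift l g) rfl _ _ rfl rfl has hbt).trans ?_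
    refine (pullMor_comp _ _ (prod.lift l g) _
      (prod.lift l (g ≫ (coverGroupoid A α).src) ≫ prod.map i (coverMap A α)) _ rfl rfl rfl).trans ?_
    exact congrArg₂ (· ≫ ·)
      (pullMor_pullMor ν.hom xD (xD ≫ e) (xD ≫ prod.map i (coverMap A α)) rfl rfl
        (prod.lift l g) _ _ rfl rfl)
      (pullMor_pullMor ν.inv zD (xD ≫ prod.map i (coverMap A α)) (zD ≫ e) hD rfl
        (prod.lift l g) _ _ rfl rfl)
  have ds' : ∀ v g, Γ.src (d (prod.mk v g)) = e (prod.mk v ((coverGroupoid A α).src g)) :=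
    fun v g => congrArg (fun m => m (prod.mk v g)) ds
  have dt' : ∀ v g, Γ.tgt (d (prod.mk v g)) = e (prod.mk v ((coverGroupoid A α).tgt g)) :=
    fun v g => congrArg (fun m => m (prod.mk v g)) dt
  have hcomp : ∀ v g h (k : (coverGroupoid A α).tgt g = (coverGroupoid A α).src h),
      d (prod.mk v ((coverGroupoid A α).comp (pb.mk g h k))) =
        Γ.comp (pb.mk (d (prod.mk v g)) (d (prod.mk v h))
          ((dt' v g).trans ((congrArg (fun m => e (prod.mk v m)) k).trans (ds' v h).symm))) := by
    intro v g h k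
    let G := coverGroupoid A α
    let x : G.arr → (point.{u} ⟶ prod V G.obj) := fun m => prod.lift (pointMap v) (pointMap (G.src m))
    let z : G.arr → (point.{u} ⟶ prod V G.obj) := fun m => prod.lift (pointMap v) (pointMap (G.tgt m))
    let D' : G.arr → (point.{u} ⟶ Γ.arr) := fun m => prod.lift (pointMap v) (pointMap m) ≫ d
    have hs : ∀ m, D' m ≫ Γ.src = x m ≫ e := fun m => by
      ext _
      exact ds' v m
    have ht : ∀ m, D' m ≫ Γ.tgt = z m ≫ e := fun m => by
      ext _
      exact dt' v m
    have hxz : ∀ m, z m ≫ prod.map i (coverMap A α) = x m ≫ prod.map i (coverMap A α) := fun m => by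
      ext _
      exact congrArg (prod.mk (i v)) (pb.condition _ _ m).symm
    have hzx : z g = x h := congrArg (fun m => prod.lift (pointMap v) (pointMap m)) k
    let gh := G.comp (pb.mk g h k)
    let l' : point.{u} ⟶ Γ.arr := pointMap (Γ.comp (pb.mk (d (prod.mk v g)) (d (prod.mk v h))
          ((dt' v g).trans ((congrArg (fun m => e (prod.mk v m)) k).trans (ds' v h).symm))))
    have hs' : l' ≫ Γ.src = x g ≫ e := by
      ext _
      exact (Γ.src_comp _ _ _).trans (ds' v g)
    have ht' : l' ≫ Γ.tgt = z h ≫ e := by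
      ext _
      exact (Γ.tgt_comp _ _ _).trans (dt' v h)
    have h0 : x h ≫ prod.map i (coverMap A α) = x g ≫ prod.map i (coverMap A α) := by
      rw [← hzx, hxz]
    have h1 : z h ≫ prod.map i (coverMap A α) = x g ≫ prod.map i (coverMap A α) := by
      rw [hxz, h0]
    -- Points of `Γ.arr` are determined by endpoints and 2-isomorphism. In the composite of two
    -- transitions the inverse of `ν` at the middle point cancels against `ν` there (`e4`), which
    -- leaves the transition of the composite arrow.
    refine congrArg (fun m => m PUnit.unit) (P.cartesian.hom_ext (l := D' gh) (l' := l') (x g ≫ e)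
      (z h ≫ e) (hs gh) (ht gh) hs' ht' ?_)
    rw [P.cocycle point (D' g) (D' h) l' (fun _ => (dt' v g).trans
      ((congrArg (fun m => e (prod.mk v m)) k).trans (ds' v h).symm)) (fun _ => rfl) (x g ≫ e)
      (z g ≫ e) (z h ≫ e) (hs g) (ht g) ((hs h).trans (by rw [hzx])) (ht h) hs' ht']
    refine (key point (pointMap v) (pointMap gh) (pointMap (G.src g)) (pointMap (G.tgt h)) rfl rfl
      _ _ rfl rfl _ rfl h1 (hs gh) (ht gh)).trans ?_
    have e1 := key point (pointMap v) (pointMap g) (pointMap (G.src g)) (pointMap (G.tgt g)) rfl rfl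
      _ _ rfl rfl _ rfl (hxz g) (hs g) (ht g)
    have e2 := key point (pointMap v) (pointMap h) (pointMap (G.src h)) (pointMap (G.tgt h)) rfl rfl
      (z g ≫ e) _ (by rw [hzx]) rfl _ h0 h1 ((hs h).trans (by rw [hzx])) (ht h)
    refine Eq.trans ?_ (congrArg₂ (· ≫ ·) e1 e2).symm
    have e3 : pullMor ν.hom (x h) (z g ≫ e) (x g ≫ prod.map i (coverMap A α)) (by rw [hzx]) h0 =
        pullMor ν.hom (z g) (z g ≫ e) (x g ≫ prod.map i (coverMap A α)) rfl (hxz g) :=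
      pullMor_congr ν.hom hzx.symm _ _ _ _
    have e4 : pullMor ν.inv (z g) (x g ≫ prod.map i (coverMap A α)) (z g ≫ e) (hxz g) rfl ≫
        pullMor ν.hom (x h) (z g ≫ e) (x g ≫ prod.map i (coverMap A α)) (by rw [hzx]) h0 = 𝟙 _ := by
      rw [e3, ← pullMor_comp, ν.inv_hom_id, pullMor_id]
    refine (congrArg (_ ≫ ·) ?_).trans (Category.assoc _ _ _).symm
    refine (Category.id_comp _).symm.trans ?_
    exact (congrArg (· ≫ _) e4.symm).trans (Category.assoc _ _ _)
  have hslice : ∀ {Y : Spc.{u}} (v : V), Continuous (fun y : Y => (prod.mk v y : prod V Y)) :=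
    fun {Y} v => kify.continuous_mk_comp (X := V × Y) (fun y => (v, y)) (by fun_prop)
  let σ : V → GroupoidHom (coverGroupoid A α) Γ := fun v =>
    { onArr := ⟨fun g => d (prod.mk v g), (continuous_hom d).comp (hslice v)⟩
      onObj := ⟨fun x => e (prod.mk v x), (continuous_hom e).comp (hslice v)⟩
      src_eq := ds' v
      tgt_eq := dt' v
      comp_eq := hcomp v }
  -- The exponential law for the arrows and for the objects of the cover groupoid, both locally
  -- compact Hausdorff.
  have hσ : Continuous σ := continuous_induced_rng.2
    ((continuous_curry d _ fun _ _ => rfl).prodMk (continuous_curry e _ fun _ _ => rfl))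
  refine ⟨mkHom (fun v => kify.mk (σ v)) (kify.continuous_mk_comp σ hσ), rfl, ?_⟩
  intro S l g x z hx hz a b ha hb c hcx hcz
  refine (congrArg (· ≫ pullMor ν.hom (prod.lift l z) b c hb hcz)
    (key S l g x z hx hz a b ha hb c hcx hcz _ _)).trans ?_
  rw [Category.assoc, ← pullMor_comp, ν.inv_hom_id, pullMor_id, Category.comp_id]

/-- An object that is trivialized along an open cover of `A` is the pullback of the universal
object along the corresponding family of groupoid morphisms. -/
theorem IsUniversalTrivialization.exists_iso (hF : IsTopStack F)
    [LocallyCompactSpace A] [T2Space A] {P : Presentation F Γ}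
    {r : fib F (prod (coverHomSpace A Γ) A)} {α : FiniteOpenCover A}
    {θ : pull (prod.map (coverHomSpaceIncl A Γ α) (coverMap A α.1)) r ≅
      pull (evObj (coverGroupoid A α.1) Γ) P.chart}
    (hθ : IsUniversalTrivialization P r α θ) {y : fib F (prod T A)} (i : V ⟶ T)
    (e : prod V (coverGroupoid A α.1).obj ⟶ Γ.obj)
    (ν : pull e P.chart ≅ pull (prod.map i (coverMap A α.1)) y) :
    ∃ σ : V ⟶ homSpace (coverGroupoid A α.1) Γ,
      Nonempty (pull (prod.map (σ ≫ coverHomSpaceIncl A Γ α) (𝟙 A)) r ≅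
        pull (prod.map i (𝟙 A)) y) := by
  obtain ⟨σ, he, hσ⟩ := P.exists_family α.1 i e ν
  refine ⟨σ, ?_⟩
  let q : Unit → (prod V (coverSpace A α.1) ⟶ prod V A) := fun _ =>
    prod.map (𝟙 V) (coverMap A α.1)
  have hq : IsCover q := (isCover_coverMap α.2.2).prod_map_right
  let θ' : pull (prod.map (σ ≫ coverHomSpaceIncl A Γ α) (coverMap A α.1)) r ⟶ pull e P.chart :=
    pullMor θ.hom (prod.map σ (𝟙 _)) _ _ rfl he
  -- Over `V × U_α` both objects are identified with the pullback of the chart, by `θ'` and by `ν`.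
  -- On overlaps both identifications change by the same arrow of `Γ` (`hθ` and `hσ`), so the
  -- composite isomorphism glues.
  obtain ⟨ψ, -⟩ := exists_glue_iso hF hq (x := r) (y := y)
    (a := prod.map (σ ≫ coverHomSpaceIncl A Γ α) (𝟙 A)) (b := prod.map i (𝟙 A))
    (fun _ => prod.map (σ ≫ coverHomSpaceIncl A Γ α) (coverMap A α.1))
    (fun _ => prod.map i (coverMap A α.1)) (fun _ => rfl) (fun _ => rfl)
    (fun _ => θ' ≫ ν.hom) (by
      intro _ _ S f g t hf hg
      obtain ⟨l, x, rfl⟩ : ∃ l x, f = prod.lift l x := ⟨f ≫ prod.fst _ _, f ≫ prod.snd _ _, rfl⟩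
      obtain ⟨l', z, rfl⟩ : ∃ l x, g = prod.lift l x := ⟨g ≫ prod.fst _ _, g ≫ prod.snd _ _, rfl⟩
      obtain rfl : l = l' := congrArg (· ≫ prod.fst _ _) (hf.trans hg.symm)
      have hxz : z ≫ coverMap A α.1 = x ≫ coverMap A α.1 :=
        congrArg (· ≫ prod.snd _ _) (hg.trans hf.symm)
      subst hf
      let k : S ⟶ (coverGroupoid A α.1).arr := pb.lift x z (fun s =>
        (congrArg (fun m => m s) hxz).symm)
      have h1 : prod.lift l z ≫ prod.map (σ ≫ coverHomSpaceIncl A Γ α) (coverMap A α.1) =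
          prod.lift l x ≫ prod.map (σ ≫ coverHomSpaceIncl A Γ α) (coverMap A α.1) :=
        congrArg (prod.lift (l ≫ σ ≫ coverHomSpaceIncl A Γ α)) hxz
      have h2 : prod.lift l z ≫ prod.map i (coverMap A α.1) =
          prod.lift l x ≫ prod.map i (coverMap A α.1) :=
        congrArg (prod.lift (l ≫ i)) hxz
      have e1 := hσ S l k x z rfl rfl _ _ rfl rfl _ rfl h2
      have e2 := hθ S (l ≫ σ) x z k rfl rfl _ rfl hxz (prod.lift l x ≫ e) (prod.lift l z ≫ e)
        (by rw [← he]; rfl) (by rw [← he]; rfl)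
      refine (pullMor_comp θ' ν.hom (prod.lift l x) _ (prod.lift l x ≫ e) _ rfl rfl rfl).trans ?_
      refine Eq.trans ?_ (pullMor_comp θ' ν.hom (prod.lift l z) _ (prod.lift l z ≫ e) _
        h1 rfl h2).symm
      have e3 := pullMor_pullMor θ.hom (prod.map σ (𝟙 _))
        (prod.map (σ ≫ coverHomSpaceIncl A Γ α) (coverMap A α.1)) e rfl he (prod.lift l x)
        _ _ rfl rfl
      have e4 := pullMor_pullMor θ.hom (prod.map σ (𝟙 _))
        (prod.map (σ ≫ coverHomSpaceIncl A Γ α) (coverMap A α.1)) e rfl he (prod.lift l z)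
        _ _ h1 rfl
      refine (congrArg₂ (· ≫ ·) e3 e1.symm).trans ?_
      refine Eq.trans ?_ (congrArg (· ≫ pullMor ν.hom _ _ _ _ _) (e2.trans e4.symm))
      exact (Category.assoc _ _ _).symm)
  exact ⟨ψ⟩

end Classify

/-! ### The chart of the mapping stack -/

section MappingStackPresentation

variable {F : CatPresheaf.{u, v, w}} {Γ : TopGroupoid.{u}}

/-- The universal family of groupoid morphisms from the groupoids of finite open covers is an
epimorphism onto the mapping stack. -/
theorem Presentation.isEpimorphism_universal (hF : IsPretopological F) (P : Presentation F Γ)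
    (A : Spc.{u}) [LocallyCompactSpace A] [T2Space A] [CompactSpace A]
    (r : fib (mappingStack A F) (coverHomSpace A Γ))
    (θ : ∀ α : FiniteOpenCover A,
      pull (F := F) (prod.map (coverHomSpaceIncl A Γ α) (coverMap A α.1)) r ≅
        pull (evObj (coverGroupoid A α.1) Γ) P.chart)
    (hθ : ∀ α, IsUniversalTrivialization P r α (θ α)) : IsEpimorphism r := by
  intro T (y : fib F (prod T A)) t
  -- Local sections of `b` are the local lifts of `y` to the chart, so a section over `V × U_α` is a
  -- trivialization along `α`.
  obtain ⟨Q, c, b, μ, hQ⟩ := hF.hasRepresentableDiagonal.isRepresentable P.chart (prod T A) y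
  obtain ⟨V, hV, α, s, hs⟩ := (hQ.isCover P.epi).exists_section_coverSpace t
  obtain ⟨σ, ⟨ψ⟩⟩ := (hθ α).exists_iso hF.isTopStack (openIncl V) (s ≫ c)
    (pullIso μ s _ _ rfl hs)
  exact ⟨_, openIncl V, V.isOpen.isOpenEmbedding_subtypeVal, ⟨⟨t, hV⟩, rfl⟩,
    σ ≫ coverHomSpaceIncl A Γ α, ⟨ψ⟩⟩

/-- Representability of `r` comes from the diagonal of the mapping stack and does not depend on the
construction of `r`. -/
theorem Presentation.exists_mappingStack_chart (hF : IsPretopological F) (P : Presentation F Γ)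
    (A : Spc.{u}) [LocallyCompactSpace A] [T2Space A] [CompactSpace A] :
    ∃ r : fib (mappingStack A F) (coverHomSpace A Γ),
      IsRepresentable r ∧ IsEpimorphism r ∧ ∀ α : FiniteOpenCover A,
        IsUniversalMorphism P A α.1
          (pull (F := mappingStack A F) (coverHomSpaceIncl _ Γ α) r) := by
  obtain ⟨r, θ, hθ⟩ := P.exists_universal hF.isTopStack A
  exact ⟨r, hF.hasRepresentableDiagonal.mappingStack.isRepresentable _,
    P.isEpimorphism_universal hF A r θ hθ, fun α => (hθ α).isUniversalMorphism⟩

end MappingStackPresentation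
end PretopStack

theorem propositionP (F : PretopStack.CatPresheaf.{u, v, w}) (hF : PretopStack.IsPretopological F)
    (A : Type u) [TopologicalSpace A] [CompactSpace A] [T2Space A] :
    PretopStack.IsPretopological
        (PretopStack.mappingStack (CompactlyGenerated.of.{u, u} A) F) ∧
    PretopStack.HasRepresentableDiagonal
        (PretopStack.mappingStack (CompactlyGenerated.of.{u, u} A) F) ∧
    (∃ Γ : PretopStack.TopGroupoid.{u}, Nonempty (PretopStack.Presentation F Γ)) ∧
    ∀ (Γ : PretopStack.TopGroupoid.{u}) (P : PretopStack.Presentation F Γ),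
      ∃ r : PretopStack.fib (PretopStack.mappingStack (CompactlyGenerated.of.{u, u} A) F)
          (PretopStack.coverHomSpace (CompactlyGenerated.of.{u, u} A) Γ),
        PretopStack.IsRepresentable r ∧ PretopStack.IsEpimorphism r ∧
        ∀ α : PretopStack.FiniteOpenCover (CompactlyGenerated.of.{u, u} A),
          PretopStack.IsUniversalMorphism P (CompactlyGenerated.of.{u, u} A) α.1
            (PretopStack.pull (F := PretopStack.mappingStack (CompactlyGenerated.of.{u, u} A) F)
              (PretopStack.coverHomSpaceIncl _ Γ α) r) := by
  have : LocallyCompactSpace (CompactlyGenerated.of.{u, u} A) :=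
    inferInstanceAs (LocallyCompactSpace A)
  have : T2Space (CompactlyGenerated.of.{u, u} A) := inferInstanceAs (T2Space A)
  have : CompactSpace (CompactlyGenerated.of.{u, u} A) := inferInstanceAs (CompactSpace A)
  obtain ⟨Γ, ⟨P⟩⟩ := hF.exists_presentation
  obtain ⟨r, hr, hr', -⟩ := P.exists_mappingStack_chart hF (CompactlyGenerated.of.{u, u} A)
  exact ⟨⟨hF.isTopStack.mappingStack _, _, r, hr, hr'⟩, hF.hasRepresentableDiagonal.mappingStack,
    ⟨Γ, ⟨P⟩⟩, fun Γ P => P.exists_mappingStack_chart hF _⟩
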